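/- **Setting.** A cell has cellular users (CUs) $1,\dots,N_C$ and device-to-device (D2D) players $1,\dots,N_D$. An action $l_d$ of player $d$ is an ordered list of $K$ distinct CUs. There are $L=N_C!/(N_C-K)!\ge 2$ such lists, and $l=(l_1,\dots,l_{N_D})$ is an action profile. A frame has $N_D$ subframes. In the $j$-th one the base station serves the players in the cyclic order $j,j+1,\dots,N_D,1,\dots,j-1$. Each player in turn is assigned the first CU of its list that is not yet assigned in this subframe (none, if all are assigned). The resources of an assigned CU $c$ are allocated to $d$ only if $\gamma_{c,d}=\frac{P_C\,g_{cB}}{P_D\,g_{dB}+N_0}\ge\gamma_{tgt}$, where all powers, gains and the noise power are positive constants. (A CU that fails this test for $d$ may either stay assigned for the rest of the subframe or be released to later players; the result holds for either convention.) With the resources of $c$, player $d$ has in this subframe the rate $\frac{B}{R_0}\log_2\bigl(a+\frac{P_D\,g_d}{P_C\,g_{cd}+N_0}\bigr)$, with bandwidth $B>0$, a normalization constant $R_0>0$ and $a=0$ or $a=1$ (the result holds for either); without resources its rate is $0$. The utility $U_d(l)$ is the average of the $N_D$ rates of $d$ in a frame with action profile $l$. Let target rates $r^{tgt}_d\in\mathbb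 R$ be given, and call $l$ feasible if $U_d(l)\ge r_d^{tgt}$ for all $d$. **The chain.** A state is a triple $s=(l,r,m)$ of an action profile, a utility profile $r\in\{(U_d(l'))_d : l' \text{ an action profile}\}$ and a mood profile $m\in\{\text{content},\text{discontent}\}^{N_D}$ such that $r_d\ge r_d^{tgt}$ for every content player $d$. Let $k$ be real with $k>N_D$ and $0\le\varepsilon<1$ (with $0^x=0$ for $x>0$). The transition matrix $P^\varepsilon$ describes one frame. From $(l,r,m)$ the players independently choose new lists: a content player keeps $l_d$ with probability $1-\varepsilon^k$ and takes each other list with probability $\varepsilon^k/(L-1)$; a discontent player takes each list with probability $1/L$. For the new profile $l'$ the new utilities are $r'_d=U_d(l')$. Then the players independently determine their moods: a content player with $(l'_d,r'_d)=(l_d,r_d)$ stays content; any other player becomes content with probability $\varepsilon^{1-r'_d}$ and discontent otherwise if $r'_d\ge r_d^{tgt}$, and becomes discontent if $r'_d<r_d^{tgt}$. **Theorem.** Assume that the utilities are normalized, $0\le U_d(l)<1$ for all $d$ and $l$; that some action profile is feasible; and that the game is interdependent: for every action profile $l$ and every nonempty proper subset $A$ of the players there are a player $d\notin A$ and an action profile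 $l'$ that agrees with $l$ outside $A$ such that $U_d(l')\ne U_d(l)$. Then: 1. $(P^\varepsilon)$ is a regular perturbation of $P^0$: all $P^\varepsilon$, $0\le\varepsilon<1$, are stochastic matrices; for $0<\varepsilon<1$ the chain is irreducible and aperiodic on the closed set of states with $r_d=U_d(l)$ for all $d$, and enters this set from every state; $P^\varepsilon\to P^0$ entrywise as $\varepsilon\to0^+$; and for any states $s,t$ with $P^\varepsilon_{st}>0$ for some $\varepsilon\in(0,1)$ there is $\rho\ge 0$ such that $\lim_{\varepsilon\to0^+}P^\varepsilon_{st}/\varepsilon^{\rho}$ exists in $(0,\infty)$. 2. For $0<\varepsilon<1$ the matrix $P^\varepsilon$ has exactly one stationary distribution $\pi^\varepsilon$, and $\pi^\varepsilon$ converges, as $\varepsilon\to 0^+$, to a stationary distribution $\pi^0$ of $P^0$. 3. A state $s=(l,r,m)$ is stochastically stable, that is, $\pi^0_s>0$, if and only if all players are content in $s$, $r_d=U_d(l)$ for every $d$, and $l$ maximizes the social utility $\sum_d U_d(l)$ over all feasible action profiles. -/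

import Mathlib

open Filter Topology

/-- A cell with `ND` D2D pairs and `NC` cellular users (CUs): powers, gains, noise, bandwidth,
normalization constant of the rates, SINR threshold of the CUs and target rates of the players. -/
structure D2DNetwork (ND NC : ℕ) where
  /-- transmit power of a CU -/
  powC : ℝ
  /-- transmit power of a D2D transmitter -/
  powD : ℝ
  /-- average noise power -/
  noise : ℝ
  /-- bandwidth -/
  bandwidth : ℝ
  /-- the constant by which rates are divided to normalize them -/
  scale : ℝ
  /-- gain from CU `c` to the base station -/
  gCB : Fin NC → ℝ
  /-- gain from the D2D transmitter `d` to the base station -/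
  gDB : Fin ND → ℝ
  /-- gain from the transmitter to the receiver of the D2D pair `d` -/
  gD : Fin ND → ℝ
  /-- gain from CU `c` to the D2D receiver `d` -/
  gCD : Fin NC → Fin ND → ℝ
  /-- least SINR that has to be kept for a CU -/
  sinrTgt : ℝ
  /-- (normalized) target rate of each D2D player -/
  rateTgt : Fin ND → ℝ
  /-- `false`: rate `B log₂ (SINR)`; `true`: rate `B log₂ (1 + SINR)` -/
  shannon : Bool
  /-- whether a CU that was assigned to a player but failed the allocation test for this player
  may be assigned to later players of the same subframe -/
  release : Bool
  powC_pos : 0 < powC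
  powD_pos : 0 < powD
  noise_pos : 0 < noise
  bandwidth_pos : 0 < bandwidth
  scale_pos : 0 < scale
  gCB_pos : ∀ c, 0 < gCB c
  gDB_pos : ∀ d, 0 < gDB d
  gD_pos : ∀ d, 0 < gD d
  gCD_pos : ∀ c d, 0 < gCD c d

/-- The mood of a D2D player. -/
inductive Mood where
  | content
  | discontent
  deriving DecidableEq

instance : Fintype Mood :=
  ⟨{Mood.content, Mood.discontent}, fun m => by cases m <;> simp⟩

/-- A list of `K` different CUs in a certain order: the action of one player. -/
abbrev CUList (NC K : ℕ) : Type := Fin K ↪ Fin NC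

/-- An action profile: one list for each D2D player. -/
abbrev ActionProfile (ND NC K : ℕ) : Type := Fin ND → CUList NC K

/-- Order in which the base station serves the players in subframe `j` of a frame:
`d_j, d_{j+1}, …`, cyclically. -/
def rrSeq {ND : ℕ} (j : Fin ND) : List (Fin ND) := (List.finRange ND).rotate j

namespace D2DNetwork

variable {ND NC K : ℕ} (N : D2DNetwork ND NC)

/-- SINR of the CU `c` when its resources are reused by the D2D pair `d`. -/
noncomputable def sinrCU (c : Fin NC) (d : Fin ND) : ℝ :=
  N.powC * N.gCB c / (N.powD * N.gDB d + N.noise)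

/-- SINR of the D2D pair `d` on the resources of the CU `c`. -/
noncomputable def sinrD2D (d : Fin ND) (c : Fin NC) : ℝ :=
  N.powD * N.gD d / (N.powC * N.gCD c d + N.noise)

/-- Normalized rate of the D2D pair `d` on the resources of the CU `c`. -/
noncomputable def rate (d : Fin ND) (c : Fin NC) : ℝ :=
  N.bandwidth * Real.logb 2 ((if N.shannon then 1 else 0) + N.sinrD2D d c) / N.scale

open Classical in
/-- The base station serves player `d`. The state consists of the CUs already assigned in the
present subframe and of the allocation so far. The first CU of the list of `d` that is not yet
assigned is assigned to `d`; it is allocated to `d` if it passes the test. -/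
noncomputable def allocStep (l : ActionProfile ND NC K)
    (st : Finset (Fin NC) × (Fin ND → Option (Fin NC))) (d : Fin ND) :
    Finset (Fin NC) × (Fin ND → Option (Fin NC)) :=
  match (List.ofFn (l d)).find? (fun c => decide (c ∉ st.1)) with
  | none => st
  | some c =>
      if N.sinrCU c d < N.sinrTgt then
        (if N.release then st.1 else insert c st.1, st.2)
      else
        (insert c st.1, Function.update st.2 d (some c))

/-- The allocation profile in subframe `j` of a frame with action profile `l`. -/
noncomputable def alloc (l : ActionProfile ND NC K) (j : Fin ND) : Fin ND → Option (Fin NC) :=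
  ((rrSeq j).foldl (N.allocStep l) (∅, fun _ => none)).2

/-- Rate that player `d` observes in subframe `j`; it is zero without allocated resources. -/
noncomputable def subframeRate (l : ActionProfile ND NC K) (j d : Fin ND) : ℝ :=
  (N.alloc l j d).elim 0 (N.rate d)

/-- Utility `U_d(l)`: average of the rates of player `d` over the `ND` subframes of a frame. -/
noncomputable def utility (l : ActionProfile ND NC K) (d : Fin ND) : ℝ :=
  (∑ j : Fin ND, N.subframeRate l j d) / ND

/-- Social utility of an action profile. -/
noncomputable def socialUtility (l : ActionProfile ND NC K) : ℝ := ∑ d, N.utility l d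

/-- All rate constraints hold. -/
def Feasible (l : ActionProfile ND NC K) : Prop := ∀ d, N.rateTgt d ≤ N.utility l d

/-- `l` maximizes the social utility subject to the rate constraints. -/
def IsOptimal (l : ActionProfile ND NC K) : Prop :=
  N.Feasible l ∧ ∀ l' : ActionProfile ND NC K, N.Feasible l' →
    N.socialUtility l' ≤ N.socialUtility l

variable (K) in
/-- Interdependence: whatever the action profile is, every nonempty proper subset `A` of the
players can affect, by a change of its own actions, the utility of some player outside `A`. -/
def Interdependent : Prop :=
  ∀ (l : ActionProfile ND NC K) (A : Finset (Fin ND)), A.Nonempty → A ≠ Finset.univ →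
    ∃ d ∉ A, ∃ l' : ActionProfile ND NC K,
      (∀ e ∉ A, l' e = l e) ∧ N.utility l' d ≠ N.utility l d

variable (K) in
/-- The system states: an action profile, a utility profile (one of those that action profiles
generate) and a mood profile, where no player is content below its target rate. -/
abbrev State : Type :=
  {s : ActionProfile ND NC K × Set.range (N.utility (K := K)) × (Fin ND → Mood) //
    ∀ d, s.2.2 d = Mood.content → N.rateTgt d ≤ s.2.1.1 d}

noncomputable instance : Fintype (N.State K) := Fintype.ofFinite _

noncomputable instance : DecidableEq (N.State K) := Classical.decEq _

/-- The action profile of a state. -/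
def State.act {N : D2DNetwork ND NC} (s : N.State K) : ActionProfile ND NC K := s.1.1

/-- The utility profile of a state. -/
def State.util {N : D2DNetwork ND NC} (s : N.State K) : Fin ND → ℝ := s.1.2.1.1

/-- The mood profile of a state. -/
def State.mood {N : D2DNetwork ND NC} (s : N.State K) : Fin ND → Mood := s.1.2.2

/-- In the state `s` the utilities are those of the action profile. -/
def State.Aligned {N : D2DNetwork ND NC} (s : N.State K) : Prop :=
  ∀ d, s.util d = N.utility s.act d

end D2DNetwork

/-- List selection: probability that a player with mood `m` and list `old` selects `new`. -/
noncomputable def listProb {NC K : ℕ} (k ε : ℝ) (m : Mood) (old new : CUList NC K) : ℝ :=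
  match m with
  | Mood.content =>
      if new = old then 1 - ε ^ k else ε ^ k / ((Fintype.card (CUList NC K) : ℝ) - 1)
  | Mood.discontent => 1 / (Fintype.card (CUList NC K) : ℝ)

open Classical in
/-- Mood calculation: probability that a player with old mood `m`, old list and utility
`(l, r)`, new list and utility `(l', r')` and target rate `t` gets the mood `m'`. -/
noncomputable def moodProb {NC K : ℕ} (ε t : ℝ) (m : Mood) (l : CUList NC K) (r : ℝ)
    (l' : CUList NC K) (r' : ℝ) (m' : Mood) : ℝ :=
  if m = Mood.content ∧ (l, r) = (l', r') then
    match m' with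
    | Mood.content => 1
    | Mood.discontent => 0
  else if t ≤ r' then
    match m' with
    | Mood.content => ε ^ (1 - r')
    | Mood.discontent => 1 - ε ^ (1 - r')
  else
    match m' with
    | Mood.content => 0
    | Mood.discontent => 1

open Classical in
/-- Transition probability from `s` to `s'` in one frame. The players select lists
independently, the new utilities are those of the new action profile, and then the players
determine their moods independently. -/
noncomputable def D2DNetwork.transition {ND NC K : ℕ} (N : D2DNetwork ND NC) (k ε : ℝ) :
    Matrix (N.State K) (N.State K) ℝ := fun s s' =>
  if s'.Aligned then
    ∏ d, listProb k ε (s.mood d) (s.act d) (s'.act d) *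
      moodProb ε (N.rateTgt d) (s.mood d) (s.act d) (s.util d) (s'.act d) (s'.util d) (s'.mood d)
  else 0

/-- `P` is the transition matrix of a Markov chain. -/
def IsTransitionMatrix {S : Type*} [Fintype S] (P : Matrix S S ℝ) : Prop :=
  (∀ s t, 0 ≤ P s t) ∧ ∀ s, ∑ t, P s t = 1

/-- `μ` is a stationary distribution of `P`. -/
def IsStationaryDist {S : Type*} [Fintype S] (P : Matrix S S ℝ) (μ : S → ℝ) : Prop :=
  (∀ s, 0 ≤ μ s) ∧ ∑ s, μ s = 1 ∧ ∀ t, ∑ s, μ s * P s t = μ t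

/-- `ρ` is the resistance of the transition from `s` to `t`. -/
def IsResistance {S : Type*} (P : ℝ → Matrix S S ℝ) (s t : S) (ρ : ℝ) : Prop :=
  0 ≤ ρ ∧ ∃ a : ℝ, 0 < a ∧ Tendsto (fun ε : ℝ => P ε s t / ε ^ ρ) (𝓝[>] 0) (𝓝 a)

/-- The matrices `P ε`, `0 < ε < 1`, are a regular perturbation of `P 0` with the recurrent
states `R`: each `P ε` is the transition matrix of a chain which is irreducible and aperiodic on
`R` and enters `R` from every state (some power of `P ε` is positive in all columns from `R`, and
no transition leads from `R` out of `R`), `P ε` converges to the transition matrix `P 0`, and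
every transition that is possible for some `ε` has a resistance. -/
def IsRegularPerturbation {S : Type*} [Fintype S] [DecidableEq S] (P : ℝ → Matrix S S ℝ)
    (R : Set S) : Prop :=
  (∀ ε ∈ Set.Ico (0 : ℝ) 1, IsTransitionMatrix (P ε)) ∧
  (∀ ε ∈ Set.Ioo (0 : ℝ) 1,
    (∃ n : ℕ, ∀ s, ∀ t ∈ R, 0 < (P ε ^ n) s t) ∧ ∀ s ∈ R, ∀ t ∉ R, P ε s t = 0) ∧
  (∀ s t, Tendsto (fun ε => P ε s t) (𝓝[>] 0) (𝓝 (P 0 s t))) ∧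
  (∀ s t, (∃ ε ∈ Set.Ioo (0 : ℝ) 1, 0 < P ε s t) → ∃ ρ, IsResistance P s t ρ)

/-! The entries of `P ε` are finite sums of real powers of `ε`. By Cramer's rule the stationary
weights are quotients of such sums (`exists_stationary_eq_div`), so on aligned states `π ε s` is
asymptotic to a positive constant times `ε ^ e s`. The limit exists and charges exactly the aligned
states with `e s = 0`; it remains to compare exponents.

This is done with a potential instead of minimum resistance trees. Let `V s` be the sum of `1 - r_d`
over the content players, `C` the set of aligned all-content states, and `κ = k` on `C`, `κ = 0`
elsewhere. A transition `s → t` with `s ≠ t` has order at most `ε ^ (V t - V s + κ s)`: becoming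
content costs `1 - r_d`, and leaving `C` requires a content player to experiment. Conversely, if `V
s ≠ 0`, some transition of order at least `ε ^ κ s` lowers `V`: in `C` one player experiments;
outside `C` interdependence lets the discontent players disturb a content one for free. Balancing
flows across the set of minimizers of `e + κ - V` then shows that this set contains a state `u` with
`V u = 0`, that is, everybody discontent (`exists_min_potential`).

Hence `e z ≥ e u + V z - k` on `C`. The direct jump from `u` to `z`, of order `ε ^ V z`, and the
exit rate of order at most `ε ^ k` from `z` give the reverse inequality. Outside `C` one has `e s ≥
e u + V s`, which exceeds the exponents on `C` because `V ≤ ND < k` there. So the exponent zero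
occurs exactly at the minimizers of `V` on `C` (`exponent_eq_zero_iff`), and there `V` is `ND` minus
the social utility of a feasible profile. -/

/-! ### Finite sums of real powers and their leading exponents at `0`. -/

/-- Evaluation at `ε` of a finite sum of real powers `∑ c_ρ ε ^ ρ`. -/
noncomputable def powerSumEval (ε : ℝ) : AddMonoidAlgebra ℝ ℝ →ₐ[ℝ] ℝ :=
  AddMonoidAlgebra.lift ℝ ℝ ℝ
    { toFun := fun ρ => Real.exp (Real.log ε * ρ.toAdd)
      map_one' := by simp
      map_mul' := fun a b => by simp [mul_add, Real.exp_add] }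

/-- The form `exp (log ε * ρ)` makes evaluation an algebra homomorphism for every real `ε`; it
agrees with `ε ^ ρ` for `ε > 0`. -/
theorem powerSumEval_eq_sum {ε : ℝ} (hε : 0 < ε) (p : AddMonoidAlgebra ℝ ℝ) :
    powerSumEval ε p = ∑ ρ ∈ p.coeff.support, p.coeff ρ * ε ^ ρ := by
  simp [powerSumEval, AddMonoidAlgebra.lift_apply, Finsupp.sum, Real.rpow_def_of_pos hε]

theorem powerSumEval_single {ε : ℝ} (hε : 0 < ε) (ρ c : ℝ) :
    powerSumEval ε (AddMonoidAlgebra.single ρ c) = c * ε ^ ρ := by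
  simp [powerSumEval, AddMonoidAlgebra.lift_single, Real.rpow_def_of_pos hε]

theorem tendsto_rpow_zero_right {x : ℝ} (hx : 0 < x) :
    Tendsto (fun ε : ℝ => ε ^ x) (𝓝[>] 0) (𝓝 0) := by
  have h : ContinuousAt (fun ε : ℝ => ε ^ x) 0 := Real.continuousAt_rpow_const _ _ (Or.inr hx.le)
  have h2 := h.tendsto
  simp only [Real.zero_rpow hx.ne'] at h2
  exact h2.mono_left nhdsWithin_le_nhds

theorem eventually_mem_Ioo : ∀ᶠ ε : ℝ in 𝓝[>] 0, ε ∈ Set.Ioo (0 : ℝ) 1 :=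
  Ioo_mem_nhdsGT one_pos

/-- A nonzero finite sum of real powers has a leading term at `0`. -/
theorem exists_leading_term {p : AddMonoidAlgebra ℝ ℝ} (hp : p ≠ 0) :
    ∃ e a : ℝ, a ≠ 0 ∧
      Tendsto (fun ε => powerSumEval ε p / ε ^ e) (𝓝[>] 0) (𝓝 a) := by
  have hne : p.coeff.support.Nonempty := by
    rw [Finsupp.support_nonempty_iff]
    intro h
    exact hp (by ext x; simp [h])
  set e := p.coeff.support.min' hne with he
  have hmem : e ∈ p.coeff.support := Finset.min'_mem _ _
  refine ⟨e, p.coeff e, Finsupp.mem_support_iff.1 hmem, ?_⟩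
  have key : Tendsto (fun ε : ℝ => ∑ ρ ∈ p.coeff.support, p.coeff ρ * ε ^ (ρ - e)) (𝓝[>] 0)
      (𝓝 (∑ ρ ∈ p.coeff.support, if ρ = e then p.coeff ρ else 0)) := by
    refine tendsto_finsetSum _ fun ρ hρ => ?_
    split_ifs with h
    · simp [h]
    · have hlt : 0 < ρ - e :=
        sub_pos.2 (lt_of_le_of_ne (Finset.min'_le _ _ hρ) (Ne.symm h))
      simpa using (tendsto_rpow_zero_right hlt).const_mul (p.coeff ρ)
  rw [Finset.sum_ite_eq' _ e, if_pos hmem] at key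
  refine key.congr' ?_
  filter_upwards [eventually_mem_Ioo] with ε hε
  rw [powerSumEval_eq_sum hε.1, Finset.sum_div]
  refine Finset.sum_congr rfl fun ρ _ => ?_
  rw [Real.rpow_sub hε.1, mul_div_assoc]

/-- `f` agrees on `(0, 1)` with a finite sum of real powers. -/
def IsPowerSum (f : ℝ → ℝ) : Prop :=
  ∃ p : AddMonoidAlgebra ℝ ℝ, ∀ ε ∈ Set.Ioo (0 : ℝ) 1, f ε = powerSumEval ε p

namespace IsPowerSum

theorem monomial (c ρ : ℝ) : IsPowerSum (fun ε => c * ε ^ ρ) :=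
  ⟨AddMonoidAlgebra.single ρ c, fun _ hε => (powerSumEval_single hε.1 _ _).symm⟩

theorem const (c : ℝ) : IsPowerSum (fun _ => c) := by
  simpa using monomial c 0

theorem rpow (ρ : ℝ) : IsPowerSum (fun ε => ε ^ ρ) := by
  simpa using monomial 1 ρ

theorem one_sub_rpow (ρ : ℝ) : IsPowerSum (fun ε => 1 - ε ^ ρ) := by
  obtain ⟨p, hp⟩ := const 1
  obtain ⟨q, hq⟩ := rpow ρ
  exact ⟨p - q, fun ε hε => by rw [map_sub, ← hp ε hε, ← hq ε hε]⟩

theorem mul {f g : ℝ → ℝ} (hf : IsPowerSum f) (hg : IsPowerSum g) :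
    IsPowerSum (fun ε => f ε * g ε) := by
  obtain ⟨p, hp⟩ := hf
  obtain ⟨q, hq⟩ := hg
  exact ⟨p * q, fun ε hε => by rw [map_mul, ← hp ε hε, ← hq ε hε]⟩

theorem prod {ι : Type*} (s : Finset ι) {f : ι → ℝ → ℝ} (hf : ∀ i, IsPowerSum (f i)) :
    IsPowerSum (fun ε => ∏ i ∈ s, f i ε) := by
  choose p hp using hf
  exact ⟨∏ i ∈ s, p i, fun ε hε => by
    rw [map_prod]; exact Finset.prod_congr rfl fun i _ => hp i ε hε⟩

end IsPowerSum

/-- Positivity at a single point rules out `p = 0` and also `q = 0`, since division by zero gives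
`0`. The leading coefficient is nonzero, and as a limit of nonnegative values it is positive. -/
theorem exists_leading_term_div {f : ℝ → ℝ} {p q : AddMonoidAlgebra ℝ ℝ}
    (h : ∀ ε ∈ Set.Ioo (0 : ℝ) 1, f ε = powerSumEval ε p / powerSumEval ε q)
    (hf : ∀ ε ∈ Set.Ioo (0 : ℝ) 1, 0 ≤ f ε) (hf' : ∃ ε ∈ Set.Ioo (0 : ℝ) 1, 0 < f ε) :
    ∃ e a : ℝ, 0 < a ∧ Tendsto (fun ε => f ε / ε ^ e) (𝓝[>] 0) (𝓝 a) := by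
  obtain ⟨ε₀, hε₀, hpos⟩ := hf'
  rw [h ε₀ hε₀] at hpos
  have hp : p ≠ 0 := by rintro rfl; simp at hpos
  have hq : q ≠ 0 := by rintro rfl; simp at hpos
  obtain ⟨e₁, a₁, ha₁, h₁⟩ := exists_leading_term hp
  obtain ⟨e₂, a₂, ha₂, h₂⟩ := exists_leading_term hq
  have h₃ : Tendsto (fun ε => f ε / ε ^ (e₁ - e₂)) (𝓝[>] 0) (𝓝 (a₁ / a₂)) := by
    refine (h₁.div h₂ ha₂).congr' ?_
    filter_upwards [eventually_mem_Ioo] with ε hε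
    have := Real.rpow_pos_of_pos hε.1 e₂
    have := Real.rpow_pos_of_pos hε.1 e₁
    rw [Pi.div_apply, h ε hε, Real.rpow_sub hε.1]
    field_simp
  refine ⟨e₁ - e₂, a₁ / a₂, lt_of_le_of_ne ?_ (div_ne_zero ha₁ ha₂).symm, h₃⟩
  refine ge_of_tendsto h₃ ?_
  filter_upwards [eventually_mem_Ioo] with ε hε
  exact div_nonneg (hf ε hε) (Real.rpow_nonneg hε.1.le _)

theorem exponent_nonneg_of_bounded {f : ℝ → ℝ} {e a C : ℝ} (ha : 0 < a)
    (h : Tendsto (fun ε => f ε / ε ^ e) (𝓝[>] 0) (𝓝 a))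
    (hf : ∀ ε ∈ Set.Ioo (0 : ℝ) 1, f ε ≤ C) : 0 ≤ e := by
  by_contra! he
  have h0 : Tendsto (fun ε : ℝ => C * ε ^ (-e)) (𝓝[>] 0) (𝓝 0) := by
    simpa using (tendsto_rpow_zero_right (neg_pos.2 he)).const_mul C
  have : a ≤ 0 := by
    refine le_of_tendsto_of_tendsto h h0 ?_
    filter_upwards [eventually_mem_Ioo] with ε hε
    rw [Real.rpow_neg hε.1.le, div_eq_mul_inv]
    exact mul_le_mul_of_nonneg_right (hf ε hε) (inv_nonneg.2 (Real.rpow_nonneg hε.1.le _))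
  linarith

/-! ### Existence, uniqueness and algebraic form of the stationary distribution. -/

section Stationary

variable {S : Type*} [Fintype S]

theorem IsStationaryDist.vecMul_eq {P : Matrix S S ℝ} {μ : S → ℝ} (h : IsStationaryDist P μ) :
    Matrix.vecMul μ P = μ :=
  funext fun t => h.2.2 t

variable [DecidableEq S]

theorem IsTransitionMatrix.pow {P : Matrix S S ℝ} (hP : IsTransitionMatrix P) (n : ℕ) :
    IsTransitionMatrix (P ^ n) := by
  induction n with
  | zero =>
    refine ⟨fun s t => ?_, fun s => ?_⟩
    · rw [pow_zero, Matrix.one_apply]; split_ifs <;> simp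
    · simp [Matrix.one_apply]
  | succ n ih =>
    refine ⟨fun s t => ?_, fun s => ?_⟩
    · rw [pow_succ, Matrix.mul_apply]
      exact Finset.sum_nonneg fun u _ => mul_nonneg (ih.1 s u) (hP.1 u t)
    · simp only [pow_succ, Matrix.mul_apply]
      rw [Finset.sum_comm]
      simp only [← Finset.mul_sum, hP.2, mul_one, ih.2]

theorem vecMul_pow_eq {P : Matrix S S ℝ} {v : S → ℝ} (h : Matrix.vecMul v P = v) (n : ℕ) :
    Matrix.vecMul v (P ^ n) = v := by
  induction n with
  | zero => simp
  | succ n ih => rw [pow_succ, ← Matrix.vecMul_vecMul, ih, h]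

omit [DecidableEq S] in
-- The triangle inequality gives `|v| ≤ |v| P` entrywise. Both sides have the same total because the
-- rows of `P` sum to one, so equality holds everywhere.
theorem abs_vecMul_eq {P : Matrix S S ℝ} (hP : IsTransitionMatrix P) {v : S → ℝ}
    (h : Matrix.vecMul v P = v) : Matrix.vecMul (fun s => |v s|) P = fun s => |v s| := by
  have hle : ∀ t, |v t| ≤ Matrix.vecMul (fun s => |v s|) P t := fun t => by
    calc |v t| = |∑ s, v s * P s t| := by
          rw [← congrFun h t]; rfl
      _ ≤ ∑ s, |v s * P s t| := Finset.abs_sum_le_sum_abs _ _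
      _ = ∑ s, |v s| * P s t :=
          Finset.sum_congr rfl fun s _ => by rw [abs_mul, abs_of_nonneg (hP.1 s t)]
  have hsum : ∑ t, |v t| = ∑ t, Matrix.vecMul (fun s => |v s|) P t := by
    simp only [Matrix.vecMul, dotProduct]
    rw [Finset.sum_comm]
    simp only [← Finset.mul_sum, hP.2, mul_one]
  funext t
  exact ((Finset.sum_eq_sum_iff_of_le fun i _ => hle i).1 hsum t (Finset.mem_univ t)).symm

/-- A signed invariant measure of total mass zero vanishes if some state can be reached from all
states in the same number of steps. -/
theorem eq_zero_of_vecMul_eq {P : Matrix S S ℝ} (hP : IsTransitionMatrix P) {n : ℕ} {t₀ : S}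
    (hpos : ∀ s, 0 < (P ^ n) s t₀) {v : S → ℝ} (h : Matrix.vecMul v P = v)
    (hsum : ∑ s, v s = 0) : v = 0 := by
  have hv := congrFun (vecMul_pow_eq h n) t₀
  have ha := congrFun (abs_vecMul_eq (hP.pow n) (vecMul_pow_eq h n)) t₀
  simp only [Matrix.vecMul, dotProduct] at hv ha
  -- Here `c = ±1` is the sign of `v t₀`. Invariance of both `v` and `|v|` at `t₀` excludes
  -- cancellation among the positively weighted terms, so all of `v` has this sign, and total mass
  -- zero forces `v = 0`.
  have key : ∀ c : ℝ, (∑ s, (|v s| - c * v s) * (P ^ n) s t₀ = 0) → |c| = 1 → v = 0 := by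
    intro c hc h1
    have hcv : ∀ s, 0 ≤ |v s| - c * v s := fun s => by
      have := le_abs_self (c * v s)
      rw [abs_mul, h1, one_mul] at this
      linarith
    have hz := (Finset.sum_eq_zero_iff_of_nonneg
      fun s _ => mul_nonneg (hcv s) (hpos s).le).1 hc
    have hz' : ∀ s, |v s| = c * v s := fun s => by
      rcases mul_eq_zero.1 (hz s (Finset.mem_univ s)) with h0 | h0
      · linarith
      · exact absurd h0 (hpos s).ne'
    have hs : ∑ s, |v s| = 0 := by
      simp only [hz', ← Finset.mul_sum, hsum, mul_zero]
    have hs' := (Finset.sum_eq_zero_iff_of_nonneg fun s _ => abs_nonneg (v s)).1 hs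
    funext s
    exact abs_eq_zero.1 (hs' s (Finset.mem_univ s))
  rcases abs_choice (v t₀) with h0 | h0
  · refine key 1 ?_ (by simp)
    simp only [sub_mul, one_mul, Finset.sum_sub_distrib, ha, hv, h0, sub_self]
  · refine key (-1) ?_ (by simp)
    simp only [neg_mul, one_mul, sub_neg_eq_add, add_mul, Finset.sum_add_distrib, ha, hv, h0,
      neg_add_cancel]

/-- The coefficients of the linear system for the stationary distribution of `P`: one of the
balance equations is replaced by the normalization. -/
def balanceMatrix {A : Type*} [CommRing A] (P : Matrix S S A) (t₀ : S) : Matrix S S A :=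
  (1 - P).updateCol t₀ (fun _ => 1)

omit [Fintype S] in
theorem balanceMatrix_map {A : Type*} [CommRing A] (f : A →+* ℝ) (P : Matrix S S A) (t₀ : S) :
    (balanceMatrix P t₀).map f = balanceMatrix (P.map f) t₀ := by
  ext s t
  by_cases h : t = t₀
  · subst h; simp [balanceMatrix]
  · simp only [balanceMatrix, Matrix.map_apply, Matrix.updateCol_ne h, Matrix.sub_apply, map_sub,
      Matrix.one_apply]
    split_ifs <;> simp

theorem vecMul_balanceMatrix_eq_iff {P : Matrix S S ℝ} (hP : IsTransitionMatrix P) (t₀ : S)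
    (v : S → ℝ) (c : ℝ) :
    Matrix.vecMul v (balanceMatrix P t₀) = Pi.single t₀ c ↔
      ∑ s, v s = c ∧ Matrix.vecMul v P = v := by
  have h₀ : Matrix.vecMul v (balanceMatrix P t₀) t₀ = ∑ s, v s := by
    simp [balanceMatrix, Matrix.vecMul, dotProduct]
  have h₁ : ∀ t, t ≠ t₀ → Matrix.vecMul v (balanceMatrix P t₀) t = v t - Matrix.vecMul v P t := by
    intro t ht
    simp [balanceMatrix, Matrix.vecMul, dotProduct, Matrix.updateCol_ne ht, mul_sub,
      Finset.sum_sub_distrib, Matrix.one_apply]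
  constructor
  · intro h
    have hne : ∀ t, t ≠ t₀ → Matrix.vecMul v P t = v t := fun t ht => by
      have := congrFun h t
      rw [h₁ t ht, Pi.single_eq_of_ne ht] at this
      linarith
    refine ⟨by rw [← h₀, h, Pi.single_eq_same], funext fun t => ?_⟩
    by_cases ht : t = t₀
    · subst ht
      -- The replaced balance equation is redundant: `v P` and `v` have the same total and agree off
      -- `t₀`.
      have htot : ∑ u, Matrix.vecMul v P u = ∑ u, v u := by
        simp only [Matrix.vecMul, dotProduct]
        rw [Finset.sum_comm]
        simp only [← Finset.mul_sum, hP.2, mul_one]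
      rw [← Finset.add_sum_erase _ _ (Finset.mem_univ t),
        ← Finset.add_sum_erase _ v (Finset.mem_univ t),
        Finset.sum_congr rfl fun u hu => hne u (Finset.ne_of_mem_erase hu)] at htot
      linarith
    · exact hne t ht
  · rintro ⟨hs, hv⟩
    funext t
    by_cases ht : t = t₀
    · subst ht; rw [h₀, hs, Pi.single_eq_same]
    · rw [h₁ t ht, hv, sub_self, Pi.single_eq_of_ne ht]

theorem isUnit_balanceMatrix {P : Matrix S S ℝ} (hP : IsTransitionMatrix P) {n : ℕ} {t₀ : S}
    (hpos : ∀ s, 0 < (P ^ n) s t₀) : IsUnit (balanceMatrix P t₀) := by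
  rw [← Matrix.vecMul_injective_iff_isUnit]
  intro v w hvw
  have h : Matrix.vecMul (v - w) (balanceMatrix P t₀) = Pi.single t₀ 0 := by
    rw [Matrix.sub_vecMul]
    simp only at hvw
    rw [hvw, sub_self, Pi.single_zero]
  obtain ⟨h₁, h₂⟩ := (vecMul_balanceMatrix_eq_iff hP t₀ _ _).1 h
  exact sub_eq_zero.1 (eq_zero_of_vecMul_eq hP hpos h₂ h₁)

theorem IsStationaryDist.eq {P : Matrix S S ℝ} (hP : IsTransitionMatrix P) {n : ℕ} {t₀ : S}
    (hpos : ∀ s, 0 < (P ^ n) s t₀) {μ ν : S → ℝ} (hμ : IsStationaryDist P μ)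
    (hν : IsStationaryDist P ν) : μ = ν := by
  refine sub_eq_zero.1 (eq_zero_of_vecMul_eq hP hpos ?_ ?_)
  · rw [Matrix.sub_vecMul, hμ.vecMul_eq, hν.vecMul_eq]
  · simp [hμ.2.1, hν.2.1]

/-- Row `t₀` of the inverse solves the linear system. For nonnegativity, `|v| - c v` with `c = ∑ |v
s|` is invariant of total mass zero, hence zero; since `c ≥ 1`, this forces `v ≥ 0`. -/
theorem isStationaryDist_inv_balanceMatrix {P : Matrix S S ℝ} (hP : IsTransitionMatrix P)
    {n : ℕ} {t₀ : S} (hpos : ∀ s, 0 < (P ^ n) s t₀) :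
    IsStationaryDist P ((balanceMatrix P t₀)⁻¹ t₀) := by
  set v := (balanceMatrix P t₀)⁻¹ t₀ with hv
  have hu := (Matrix.isUnit_iff_isUnit_det _).1 (isUnit_balanceMatrix hP hpos)
  have hvM : Matrix.vecMul v (balanceMatrix P t₀) = Pi.single t₀ 1 := by
    have : v = Matrix.vecMul (Pi.single t₀ 1) (balanceMatrix P t₀)⁻¹ := by
      rw [Matrix.single_one_vecMul]; rfl
    rw [this, Matrix.vecMul_vecMul, Matrix.nonsing_inv_mul _ hu, Matrix.vecMul_one]
  obtain ⟨h₁, h₂⟩ := (vecMul_balanceMatrix_eq_iff hP t₀ _ _).1 hvM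
  have habs := abs_vecMul_eq hP h₂
  set c := ∑ s, |v s| with hc
  have hzero : (fun s => |v s|) - c • v = 0 := by
    refine eq_zero_of_vecMul_eq hP hpos ?_ ?_
    · rw [Matrix.sub_vecMul, Matrix.smul_vecMul, habs, h₂]
    · simp [Finset.sum_sub_distrib, ← Finset.mul_sum, h₁, hc]
  have hc1 : 1 ≤ c := by
    rw [← h₁]; exact Finset.sum_le_sum fun s _ => le_abs_self _
  refine ⟨fun s => ?_, h₁, fun t => congrFun h₂ t⟩
  have hs := congrFun hzero s
  simp only [Pi.sub_apply, Pi.smul_apply, smul_eq_mul, Pi.zero_apply] at hs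
  by_contra! hneg
  have := abs_nonneg (v s)
  nlinarith

theorem IsStationaryDist.pos {P : Matrix S S ℝ} {n : ℕ} {t : S}
    (hpos : ∀ s, 0 < (P ^ n) s t) {μ : S → ℝ} (hμ : IsStationaryDist P μ) : 0 < μ t := by
  have h := congrFun (vecMul_pow_eq hμ.vecMul_eq n) t
  rw [← h]
  have h1 : 0 < ∑ s, μ s := by rw [hμ.2.1]; exact one_pos
  obtain ⟨s, hs, hs'⟩ := Finset.exists_lt_of_sum_lt (s := Finset.univ)
    (f := fun _ => (0 : ℝ)) (g := μ) (by simpa using h1)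
  exact Finset.sum_pos' (fun u _ => mul_nonneg (hμ.1 u) (hpos u).le)
    ⟨s, hs, mul_pos hs' (hpos s)⟩

omit [DecidableEq S] in
theorem IsStationaryDist.le_one {P : Matrix S S ℝ} {μ : S → ℝ} (hμ : IsStationaryDist P μ)
    (s : S) : μ s ≤ 1 := by
  rw [← hμ.2.1]
  exact Finset.single_le_sum (f := μ) (fun u _ => hμ.1 u) (Finset.mem_univ s)

/-- If the entries of the transition matrices are finite sums of powers of `ε`, then the
stationary distributions are quotients of such sums. -/
theorem exists_stationary_eq_div {P : ℝ → Matrix S S ℝ}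
    (hsum : ∀ s t, IsPowerSum (fun ε => P ε s t))
    (hP : ∀ ε ∈ Set.Ioo (0 : ℝ) 1, IsTransitionMatrix (P ε)) (t₀ : S)
    (hpos : ∀ ε ∈ Set.Ioo (0 : ℝ) 1, ∃ n : ℕ, ∀ s, 0 < (P ε ^ n) s t₀) :
    ∃ π : ℝ → S → ℝ,
      (∀ ε ∈ Set.Ioo (0 : ℝ) 1, IsStationaryDist (P ε) (π ε) ∧
        ∀ μ, IsStationaryDist (P ε) μ → μ = π ε) ∧
      ∀ s, ∃ p q : AddMonoidAlgebra ℝ ℝ, ∀ ε ∈ Set.Ioo (0 : ℝ) 1,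
        π ε s = powerSumEval ε p / powerSumEval ε q := by
  choose Q hQ using hsum
  refine ⟨fun ε => (balanceMatrix (P ε) t₀)⁻¹ t₀, fun ε hε => ?_, fun s => ?_⟩
  · obtain ⟨n, hn⟩ := hpos ε hε
    have h := isStationaryDist_inv_balanceMatrix (hP ε hε) hn
    exact ⟨h, fun μ hμ => hμ.eq (hP ε hε) hn h⟩
  -- Cramer's rule over the algebra of power sums: adjugate and determinant commute with evaluation
  -- at `ε`.
  · set M := balanceMatrix (Matrix.of Q) t₀ with hM
    refine ⟨M.adjugate t₀ s, M.det, fun ε hε => ?_⟩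
    have hmap : balanceMatrix (P ε) t₀ = (powerSumEval ε : _ →+* ℝ).mapMatrix M := by
      rw [RingHom.mapMatrix_apply, hM, balanceMatrix_map]
      congr 1
      ext i j
      exact hQ i j ε hε
    change (balanceMatrix (P ε) t₀)⁻¹ t₀ s = _
    rw [Matrix.inv_def, hmap, ← RingHom.map_det, ← RingHom.map_adjugate]
    simp [Ring.inverse_eq_inv', div_eq_inv_mul]

end Stationary

/-! ### Comparison of asymptotic exponents. -/

theorem tendsto_div_rpow_zero {f : ℝ → ℝ} {e a x : ℝ}
    (h : Tendsto (fun ε => f ε / ε ^ e) (𝓝[>] 0) (𝓝 a)) (hx : x < e) :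
    Tendsto (fun ε => f ε / ε ^ x) (𝓝[>] 0) (𝓝 0) := by
  have := h.mul (tendsto_rpow_zero_right (sub_pos.2 hx))
  rw [mul_zero] at this
  refine this.congr' ?_
  filter_upwards [eventually_mem_Ioo] with ε hε
  have := Real.rpow_pos_of_pos hε.1 e
  have := Real.rpow_pos_of_pos hε.1 x
  rw [Real.rpow_sub hε.1]
  field_simp

theorem exponent_le_of_le {f g : ℝ → ℝ} {x y a b : ℝ} (ha : 0 < a)
    (hf : Tendsto (fun ε => f ε / ε ^ x) (𝓝[>] 0) (𝓝 a))
    (hg : Tendsto (fun ε => g ε / ε ^ y) (𝓝[>] 0) (𝓝 b))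
    (h : ∀ᶠ ε in 𝓝[>] 0, f ε ≤ g ε) : y ≤ x := by
  by_contra! hxy
  have : a ≤ 0 := by
    refine le_of_tendsto_of_tendsto hf (tendsto_div_rpow_zero hg hxy) ?_
    filter_upwards [eventually_mem_Ioo, h] with ε hε hle
    exact div_le_div_of_nonneg_right hle (Real.rpow_nonneg hε.1.le _)
  linarith

theorem tendsto_mul_rpow_div {f : ℝ → ℝ} {e a : ℝ} (c x : ℝ)
    (h : Tendsto (fun ε => f ε / ε ^ e) (𝓝[>] 0) (𝓝 a)) :
    Tendsto (fun ε => f ε * (c * ε ^ x) / ε ^ (e + x)) (𝓝[>] 0) (𝓝 (c * a)) := by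
  refine (h.const_mul c).congr' ?_
  filter_upwards [eventually_mem_Ioo] with ε hε
  have := Real.rpow_pos_of_pos hε.1 e
  have := Real.rpow_pos_of_pos hε.1 x
  rw [Real.rpow_add hε.1]
  field_simp

/-! ### Exponents of the stationary weights from a potential. -/

section Stationary

variable {S : Type*} [Fintype S] [DecidableEq S]

/-- In equilibrium the flows through a cut balance. -/
theorem IsStationaryDist.flow_eq {P : Matrix S S ℝ} (hP : IsTransitionMatrix P) {μ : S → ℝ}
    (hμ : IsStationaryDist P μ) (A : Finset S) :
    ∑ s ∈ A, ∑ t ∈ Aᶜ, μ s * P s t = ∑ s ∈ Aᶜ, ∑ t ∈ A, μ s * P s t := by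
  have h₁ : ∑ s ∈ A, μ s = ∑ s ∈ A, ∑ t ∈ A, μ s * P s t + ∑ s ∈ A, ∑ t ∈ Aᶜ, μ s * P s t := by
    rw [← Finset.sum_add_distrib]
    refine Finset.sum_congr rfl fun s _ => ?_
    rw [Finset.sum_add_sum_compl, ← Finset.mul_sum, hP.2, mul_one]
  have h₂ : ∑ t ∈ A, μ t = ∑ s ∈ A, ∑ t ∈ A, μ s * P s t + ∑ s ∈ Aᶜ, ∑ t ∈ A, μ s * P s t := by
    rw [Finset.sum_add_sum_compl, Finset.sum_comm]
    exact Finset.sum_congr rfl fun t _ => (hμ.2.2 t).symm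
  linarith

variable {P : ℝ → Matrix S S ℝ} {R : Set S} {π : ℝ → S → ℝ} {e : S → ℝ}

/-- If a transition out of `A` carries a flow of order at least `ε ^ x` in equilibrium, then some
transition into `A` does. -/
theorem exists_inflow (hP : ∀ ε ∈ Set.Ioo (0 : ℝ) 1, IsTransitionMatrix (P ε))
    (hπ : ∀ ε ∈ Set.Ioo (0 : ℝ) 1, IsStationaryDist (P ε) (π ε)) {A : Finset S} {s₀ t₀ : S}
    (hs₀ : s₀ ∈ A) (ht₀ : t₀ ∉ A) {x c : ℝ} (hc : 0 < c)
    (hout : ∀ᶠ ε in 𝓝[>] 0, c * ε ^ x ≤ π ε s₀ * P ε s₀ t₀) :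
    ∃ s ∉ A, ∃ t ∈ A, ¬ Tendsto (fun ε => π ε s * P ε s t / ε ^ x) (𝓝[>] 0) (𝓝 0) := by
  by_contra! h
  have h0 : Tendsto (fun ε => ∑ s ∈ Aᶜ, ∑ t ∈ A, π ε s * P ε s t / ε ^ x) (𝓝[>] 0) (𝓝 0) := by
    have := tendsto_finsetSum Aᶜ fun s hs => tendsto_finsetSum A fun t ht =>
      h s (Finset.mem_compl.1 hs) t ht
    simpa using this
  have : c ≤ 0 := by
    refine ge_of_tendsto h0 ?_
    filter_upwards [eventually_mem_Ioo, hout] with ε hε hle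
    have hx := Real.rpow_pos_of_pos hε.1 x
    have hnn : ∀ s t, 0 ≤ π ε s * P ε s t := fun s t =>
      mul_nonneg ((hπ ε hε).1 s) ((hP ε hε).1 s t)
    simp only [← Finset.sum_div]
    rw [le_div_iff₀ hx, ← (hπ ε hε).flow_eq (hP ε hε)]
    refine hle.trans ?_
    refine le_trans ?_ (Finset.single_le_sum (f := fun s => ∑ t ∈ Aᶜ, π ε s * P ε s t)
      (fun s _ => Finset.sum_nonneg fun t _ => hnn s t) hs₀)
    exact Finset.single_le_sum (f := fun t => π ε s₀ * P ε s₀ t) (fun t _ => hnn s₀ t)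
      (Finset.mem_compl.2 ht₀)
  linarith

/-- Let `e` be the exponents of the stationary weights. Suppose that transitions `s → t` have
order at most `ε ^ (V t - V s + κ s)`, and that from every state that does not minimize `V` a
transition of order at least `ε ^ κ s` decreases `V`. Then `e s + κ s - V s` is minimal at a
minimizer of `V`. -/
theorem exists_min_potential (hP : ∀ ε ∈ Set.Ioo (0 : ℝ) 1, IsTransitionMatrix (P ε))
    (hπ : ∀ ε ∈ Set.Ioo (0 : ℝ) 1, IsStationaryDist (P ε) (π ε))
    (he : ∀ s ∈ R, ∃ a : ℝ, 0 < a ∧ Tendsto (fun ε => π ε s / ε ^ e s) (𝓝[>] 0) (𝓝 a))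
    (hR : ∀ s ∉ R, ∀ ε ∈ Set.Ioo (0 : ℝ) 1, π ε s = 0) (hne : R.Nonempty)
    {V κ : S → ℝ}
    (hup : ∀ s ∈ R, ∀ t ∈ R, s ≠ t → ∀ ε ∈ Set.Ioo (0 : ℝ) 1,
      P ε s t ≤ ε ^ (V t - V s + κ s))
    (hdown : ∀ s ∈ R, V s ≠ 0 → ∃ t, V t < V s ∧ ∃ c : ℝ, 0 < c ∧
      ∀ᶠ ε in 𝓝[>] 0, c * ε ^ κ s ≤ P ε s t) :
    ∃ u ∈ R, V u = 0 ∧ ∀ s ∈ R, e u + κ u - V u ≤ e s + κ s - V s := by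
  classical
  obtain ⟨s₁, hs₁, hmin⟩ := Finset.exists_min_image (Finset.univ.filter (· ∈ R))
    (fun s => e s + κ s - V s) (by obtain ⟨s, hs⟩ := hne; exact ⟨s, by simpa using hs⟩)
  simp only [Finset.mem_filter, Finset.mem_univ, true_and] at hs₁ hmin
  set δ := e s₁ + κ s₁ - V s₁ with hδ
  -- The cut is the set `A` of minimizers of `e + κ - V`. Its element `u` of least `V` would, if `V
  -- u ≠ 0`, send flow of order at least `ε ^ (e u + κ u)` to a state of lower `V`, hence outside
  -- `A`.
  set A := Finset.univ.filter (fun s => s ∈ R ∧ e s + κ s - V s = δ) with hA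
  have hmemA : ∀ s, s ∈ A ↔ s ∈ R ∧ e s + κ s - V s = δ := by simp [hA]
  obtain ⟨u, hu, humin⟩ := Finset.exists_min_image A V ⟨s₁, by simp [hmemA, hs₁, hδ]⟩
  have huR := ((hmemA u).1 hu).1
  have huδ := ((hmemA u).1 hu).2
  refine ⟨u, huR, ?_, fun s hs => by rw [huδ]; exact hmin s hs⟩
  by_contra hV
  obtain ⟨t₀, ht₀, c, hc, hlow⟩ := hdown u huR hV
  have ht₀A : t₀ ∉ A := fun h => absurd (humin t₀ h) (not_le.2 ht₀)
  obtain ⟨a, ha, hlim⟩ := he u huR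
  have hout : ∀ᶠ ε in 𝓝[>] 0, a / 2 * c * ε ^ (e u + κ u) ≤ π ε u * P ε u t₀ := by
    filter_upwards [eventually_mem_Ioo, hlow, hlim.eventually_const_lt (half_lt_self ha)]
      with ε hε h₁ h₂
    have hx := Real.rpow_pos_of_pos hε.1 (e u)
    rw [lt_div_iff₀ hx] at h₂
    calc a / 2 * c * ε ^ (e u + κ u) = (a / 2 * ε ^ e u) * (c * ε ^ κ u) := by
          rw [Real.rpow_add hε.1]; ring
      _ ≤ π ε u * P ε u t₀ :=
          mul_le_mul h₂.le h₁ (mul_nonneg hc.le (Real.rpow_nonneg hε.1.le _)) ((hπ ε hε).1 u)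
  obtain ⟨s, hs, t, ht, hst⟩ := exists_inflow hP hπ hu ht₀A (by positivity) hout
  apply hst
  by_cases hsR : s ∈ R
  · obtain ⟨b, hb, hlims⟩ := he s hsR
    have htR := ((hmemA t).1 ht).1
    have hlt : δ < e s + κ s - V s :=
      lt_of_le_of_ne (hmin s hsR) fun h => hs ((hmemA s).2 ⟨hsR, h.symm⟩)
    have hVt := humin t ht
    -- The inflow `s → t` has exponent at least `(e s + κ s - V s) + V t > δ + V u = e u + κ u`, so
    -- it is negligible against the outflow.
    have h₀ := tendsto_div_rpow_zero (tendsto_mul_rpow_div 1 (V t - V s + κ s) hlims)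
      (x := e u + κ u) (by linarith)
    refine squeeze_zero' ?_ ?_ h₀
    · filter_upwards [eventually_mem_Ioo] with ε hε
      exact div_nonneg (mul_nonneg ((hπ ε hε).1 s) ((hP ε hε).1 s t))
        (Real.rpow_nonneg hε.1.le _)
    · filter_upwards [eventually_mem_Ioo] with ε hε
      rw [one_mul]
      exact div_le_div_of_nonneg_right (mul_le_mul_of_nonneg_left
        (hup s hsR t htR (fun h => hs (h ▸ ht)) ε hε) ((hπ ε hε).1 s))
        (Real.rpow_nonneg hε.1.le _)
  · refine tendsto_const_nhds.congr' ?_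
    filter_upwards [eventually_mem_Ioo] with ε hε
    rw [hR s hsR ε hε, zero_mul, zero_div]

/-- Balance at `z` alone: the inflow from `u` is at most the mass `π z * (1 - P z z)` that leaves
`z`. -/
theorem exponent_le_of_transition (hP : ∀ ε ∈ Set.Ioo (0 : ℝ) 1, IsTransitionMatrix (P ε))
    (hπ : ∀ ε ∈ Set.Ioo (0 : ℝ) 1, IsStationaryDist (P ε) (π ε)) {u z : S} (huz : u ≠ z)
    {x y a b c C k : ℝ} (ha : 0 < a) (hc : 0 < c)
    (hu : Tendsto (fun ε => π ε u / ε ^ x) (𝓝[>] 0) (𝓝 a))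
    (hz : Tendsto (fun ε => π ε z / ε ^ y) (𝓝[>] 0) (𝓝 b)) {v : ℝ}
    (hin : ∀ ε ∈ Set.Ioo (0 : ℝ) 1, c * ε ^ v ≤ P ε u z)
    (hstay : ∀ ε ∈ Set.Ioo (0 : ℝ) 1, 1 - P ε z z ≤ C * ε ^ k) : y + k ≤ x + v := by
  refine exponent_le_of_le (mul_pos hc ha) (tendsto_mul_rpow_div c v hu)
    (tendsto_mul_rpow_div C k hz) ?_
  filter_upwards [eventually_mem_Ioo] with ε hε
  have hnn : ∀ s, 0 ≤ π ε s * P ε s z := fun s =>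
    mul_nonneg ((hπ ε hε).1 s) ((hP ε hε).1 s z)
  have hbal : π ε u * P ε u z + π ε z * P ε z z ≤ π ε z := by
    calc π ε u * P ε u z + π ε z * P ε z z = ∑ s ∈ {u, z}, π ε s * P ε s z := by
          rw [Finset.sum_pair huz]
      _ ≤ ∑ s, π ε s * P ε s z :=
          Finset.sum_le_sum_of_subset_of_nonneg (Finset.subset_univ _) fun s _ _ => hnn s
      _ = π ε z := (hπ ε hε).2.2 z
  calc π ε u * (c * ε ^ v) ≤ π ε u * P ε u z :=
        mul_le_mul_of_nonneg_left (hin ε hε) ((hπ ε hε).1 u)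
    _ ≤ π ε z * (1 - P ε z z) := by linarith
    _ ≤ π ε z * (C * ε ^ k) := mul_le_mul_of_nonneg_left (hstay ε hε) ((hπ ε hε).1 z)

omit [DecidableEq S] in
-- Weights are at most one, so exponents are nonnegative. The limit is the leading coefficient when
-- the exponent is zero, and `0` otherwise; the stationarity equations pass to the limit.
theorem exists_limit_of_exponents
    (hπ : ∀ ε ∈ Set.Ioo (0 : ℝ) 1, IsStationaryDist (P ε) (π ε))
    (he : ∀ s ∈ R, ∃ a : ℝ, 0 < a ∧ Tendsto (fun ε => π ε s / ε ^ e s) (𝓝[>] 0) (𝓝 a))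
    (hR : ∀ s ∉ R, ∀ ε ∈ Set.Ioo (0 : ℝ) 1, π ε s = 0)
    (hlim : ∀ s t, Tendsto (fun ε => P ε s t) (𝓝[>] 0) (𝓝 (P 0 s t))) :
    ∃ π₀ : S → ℝ, Tendsto π (𝓝[>] 0) (𝓝 π₀) ∧ IsStationaryDist (P 0) π₀ ∧
      ∀ s, 0 < π₀ s ↔ s ∈ R ∧ e s = 0 := by
  have hs : ∀ s, ∃ a : ℝ, Tendsto (fun ε => π ε s) (𝓝[>] 0) (𝓝 a) ∧
      (0 < a ↔ s ∈ R ∧ e s = 0) := by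
    intro s
    by_cases hsR : s ∈ R
    · obtain ⟨a, ha, h⟩ := he s hsR
      rcases (exponent_nonneg_of_bounded ha h fun ε hε => (hπ ε hε).le_one s).eq_or_lt
        with h0 | h0
      · exact ⟨a, by simpa [← h0] using h, by simp [ha, hsR, ← h0]⟩
      · exact ⟨0, by simpa using tendsto_div_rpow_zero h h0, by simp [h0.ne']⟩
    · refine ⟨0, tendsto_const_nhds.congr' ?_, by simp [hsR]⟩
      filter_upwards [eventually_mem_Ioo] with ε hε
      exact (hR s hsR ε hε).symm
  choose π₀ h₁ h₂ using hs
  refine ⟨π₀, tendsto_pi_nhds.2 h₁, ⟨fun s => ?_, ?_, fun t => ?_⟩, h₂⟩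
  · refine ge_of_tendsto (h₁ s) ?_
    filter_upwards [eventually_mem_Ioo] with ε hε
    exact (hπ ε hε).1 s
  · refine tendsto_nhds_unique (tendsto_finsetSum Finset.univ fun s _ => h₁ s)
      (tendsto_const_nhds.congr' ?_)
    filter_upwards [eventually_mem_Ioo] with ε hε
    exact (hπ ε hε).2.1.symm
  · refine tendsto_nhds_unique
      (tendsto_finsetSum Finset.univ fun s _ => (h₁ s).mul (hlim s t)) ((h₁ t).congr' ?_)
    filter_upwards [eventually_mem_Ioo] with ε hε
    exact ((hπ ε hε).2.2 t).symm

/-- Stochastic stability from a potential: `C` is the set of states that are left at a rate of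
order `ε ^ k`, while all other states can decrease the potential `V` at a rate of order `1`. -/
theorem exponent_eq_zero_iff (hP : ∀ ε ∈ Set.Ioo (0 : ℝ) 1, IsTransitionMatrix (P ε))
    (hπ : ∀ ε ∈ Set.Ioo (0 : ℝ) 1, IsStationaryDist (P ε) (π ε))
    (he : ∀ s ∈ R, ∃ a : ℝ, 0 < a ∧ Tendsto (fun ε => π ε s / ε ^ e s) (𝓝[>] 0) (𝓝 a))
    (hR : ∀ s ∉ R, ∀ ε ∈ Set.Ioo (0 : ℝ) 1, π ε s = 0) (hzero : ∃ s ∈ R, e s = 0)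
    {V κ : S → ℝ} {C : Set S} {k : ℝ} (hCR : C ⊆ R) (hC : C.Nonempty)
    (hκ : ∀ s ∈ C, κ s = k) (hκ' : ∀ s ∉ C, κ s = 0) (hV : ∀ s ∈ R, 0 ≤ V s)
    (hVC : ∀ s ∈ C, V s < k) (hVC' : ∀ s ∈ C, V s ≠ 0)
    (hup : ∀ s ∈ R, ∀ t ∈ R, s ≠ t → ∀ ε ∈ Set.Ioo (0 : ℝ) 1,
      P ε s t ≤ ε ^ (V t - V s + κ s))
    (hdown : ∀ s ∈ R, V s ≠ 0 → ∃ t, V t < V s ∧ ∃ c : ℝ, 0 < c ∧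
      ∀ᶠ ε in 𝓝[>] 0, c * ε ^ κ s ≤ P ε s t)
    (hin : ∀ u ∈ R, V u = 0 → ∀ z ∈ C, ∃ c : ℝ, 0 < c ∧
      ∀ ε ∈ Set.Ioo (0 : ℝ) 1, c * ε ^ V z ≤ P ε u z)
    (hstay : ∀ z ∈ C, ∃ c : ℝ, ∀ ε ∈ Set.Ioo (0 : ℝ) 1, 1 - P ε z z ≤ c * ε ^ k) (s : S)
    (hs : s ∈ R) : e s = 0 ↔ s ∈ C ∧ ∀ z ∈ C, V s ≤ V z := by
  have hnn : ∀ s ∈ R, 0 ≤ e s := fun s hs => by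
    obtain ⟨a, ha, h⟩ := he s hs
    exact exponent_nonneg_of_bounded ha h fun ε hε => (hπ ε hε).le_one s
  obtain ⟨u, huR, hVu, hmin⟩ := exists_min_potential hP hπ he hR
    (hC.mono hCR) hup hdown
  have huC : u ∉ C := fun h => hVC' u h hVu
  rw [hκ' u huC, hVu] at hmin
  have heC : ∀ z ∈ C, e z = e u + V z - k := by
    intro z hz
    have h₁ := hmin z (hCR hz)
    rw [hκ z hz] at h₁
    obtain ⟨a, ha, hu⟩ := he u huR
    obtain ⟨b, hb, hz'⟩ := he z (hCR hz)
    obtain ⟨c, hc, hin'⟩ := hin u huR hVu z hz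
    obtain ⟨c', hstay'⟩ := hstay z hz
    have h₂ := exponent_le_of_transition hP hπ (ne_of_mem_of_not_mem hz huC).symm ha hc hu hz' hin' hstay'
    linarith
  -- Outside `C`, `e s ≥ e u + V s ≥ e u = e z + k - V z > 0` for any `z ∈ C`.
  have hmem : ∀ s ∈ R, e s = 0 → s ∈ C := by
    intro s hs h0
    by_contra hsC
    obtain ⟨z, hz⟩ := hC
    have h₁ := hmin s hs
    rw [hκ' s hsC] at h₁
    have := hnn z (hCR hz)
    have := heC z hz
    have := hVC z hz
    have := hV s hs
    linarith
  constructor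
  · intro h0
    have hsC := hmem s hs h0
    refine ⟨hsC, fun z hz => ?_⟩
    have := hnn z (hCR hz)
    rw [heC z hz] at this
    rw [heC s hsC] at h0
    linarith
  · rintro ⟨hsC, hle⟩
    obtain ⟨s₀, hs₀, h0⟩ := hzero
    have hs₀C := hmem s₀ hs₀ h0
    have := hle s₀ hs₀C
    have := hnn s hs
    rw [heC s hsC] at this ⊢
    rw [heC s₀ hs₀C] at h0
    linarith

end Stationary

/-! ### List and mood probabilities of a single player. -/

section PlayerProbabilities

variable {NC K : ℕ}

theorem listProb_nonneg {k ε : ℝ} (hε : ε ∈ Set.Ico (0 : ℝ) 1) (hk : 0 < k)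
    (hL : 2 ≤ Fintype.card (CUList NC K)) (m : Mood) (old new : CUList NC K) :
    0 ≤ listProb k ε m old new := by
  have hL' : (2 : ℝ) ≤ Fintype.card (CUList NC K) := by exact_mod_cast hL
  have h0 := Real.rpow_nonneg hε.1 k
  have h1 := Real.rpow_le_one hε.1 hε.2.le hk.le
  unfold listProb
  cases m
  · dsimp only
    split_ifs
    · linarith
    · exact div_nonneg h0 (by linarith)
  · positivity

theorem listProb_pos {k ε : ℝ} (hε : ε ∈ Set.Ioo (0 : ℝ) 1) (hk : 0 < k)
    (hL : 2 ≤ Fintype.card (CUList NC K)) (m : Mood) (old new : CUList NC K) :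
    0 < listProb k ε m old new := by
  have hL' : (2 : ℝ) ≤ Fintype.card (CUList NC K) := by exact_mod_cast hL
  have h0 := Real.rpow_pos_of_pos hε.1 k
  have h1 := Real.rpow_lt_one hε.1.le hε.2 hk
  unfold listProb
  cases m
  · dsimp only
    split_ifs
    · linarith
    · exact div_pos h0 (by linarith)
  · positivity

theorem sum_listProb (k ε : ℝ) (hL : 2 ≤ Fintype.card (CUList NC K)) (m : Mood)
    (old : CUList NC K) : ∑ new, listProb k ε m old new = 1 := by
  have hL' : (2 : ℝ) ≤ Fintype.card (CUList NC K) := by exact_mod_cast hL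
  unfold listProb
  cases m
  · dsimp only
    rw [← Finset.add_sum_erase _ _ (Finset.mem_univ old), if_pos rfl,
      Finset.sum_congr rfl fun x hx => if_neg (Finset.ne_of_mem_erase hx), Finset.sum_const,
      Finset.card_erase_of_mem (Finset.mem_univ old), Finset.card_univ, nsmul_eq_mul,
      Nat.cast_sub (by omega)]
    have : (Fintype.card (CUList NC K) : ℝ) - 1 ≠ 0 := by linarith
    push_cast
    field_simp
    ring
  · have : (Fintype.card (CUList NC K) : ℝ) ≠ 0 := by linarith
    dsimp only
    rw [Finset.sum_const, Finset.card_univ, nsmul_eq_mul]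
    field_simp

/-- Exponent of `ε` in the probability of a list selection. -/
noncomputable def listCost (k : ℝ) (m : Mood) (old new : CUList NC K) : ℝ :=
  if m = Mood.content ∧ new ≠ old then k else 0

theorem listProb_le {k ε : ℝ} (hε : ε ∈ Set.Ioo (0 : ℝ) 1)
    (hL : 2 ≤ Fintype.card (CUList NC K)) (m : Mood) (old new : CUList NC K) :
    listProb k ε m old new ≤ ε ^ listCost k m old new := by
  have hL' : (2 : ℝ) ≤ Fintype.card (CUList NC K) := by exact_mod_cast hL
  have h0 := Real.rpow_pos_of_pos hε.1 k
  unfold listProb listCost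
  cases m
  · by_cases h : new = old
    · simp [h, h0.le]
    · simpa [h, -Fintype.card_embedding_eq] using div_le_self h0.le (by linarith)
  · simpa [-Fintype.card_embedding_eq] using inv_le_one_of_one_le₀ (by linarith)

/-- With `L` lists, the constant `1 / (2L)` lies below `1 / L`, below `1 / (L - 1)`, and below `1 -
ε ^ k` once `ε ^ k < 1 / 2`. -/
theorem eventually_le_listProb {k : ℝ} (hk : 0 < k)
    (hL : 2 ≤ Fintype.card (CUList NC K)) (m : Mood) (old new : CUList NC K) :
    ∀ᶠ ε in 𝓝[>] 0, 1 / (2 * Fintype.card (CUList NC K) : ℝ) * ε ^ listCost k m old new ≤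
      listProb k ε m old new := by
  have hL' : (2 : ℝ) ≤ Fintype.card (CUList NC K) := by exact_mod_cast hL
  set L : ℝ := ((Fintype.card (CUList NC K) : ℕ) : ℝ)
  have hhalf : 1 / (2 * L) ≤ 1 / 2 := by
    apply one_div_le_one_div_of_le <;> linarith
  filter_upwards [eventually_mem_Ioo,
    (tendsto_rpow_zero_right hk).eventually_lt_const one_half_pos] with ε hε hsmall
  have h0 := Real.rpow_pos_of_pos hε.1 k
  unfold listProb listCost
  cases m
  · by_cases h : new = old
    · simp only [h, if_true, ne_eq, not_true, and_false, if_false, Real.rpow_zero]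
      linarith
    · simp only [h, if_false, ne_eq, not_false_iff, and_self, if_true]
      rw [one_div_mul_eq_div]
      exact div_le_div_of_nonneg_left h0.le (by linarith) (by linarith)
  · simp only [reduceCtorEq, false_and, if_false, Real.rpow_zero, mul_one]
    apply one_div_le_one_div_of_le <;> linarith

theorem isPowerSum_listProb (k : ℝ) (m : Mood) (old new : CUList NC K) :
    IsPowerSum (fun ε => listProb k ε m old new) := by
  unfold listProb
  cases m
  · dsimp only
    split_ifs
    · exact .one_sub_rpow k
    · simpa only [div_eq_inv_mul] using IsPowerSum.monomial _ k
  · exact .const _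

theorem tendsto_rpow_nhdsGT_zero {x : ℝ} (hx : 0 < x) :
    Tendsto (fun ε : ℝ => ε ^ x) (𝓝[>] 0) (𝓝 ((0 : ℝ) ^ x)) := by
  rw [Real.zero_rpow hx.ne']
  exact tendsto_rpow_zero_right hx

theorem tendsto_listProb {k : ℝ} (hk : 0 < k) (m : Mood) (old new : CUList NC K) :
    Tendsto (fun ε => listProb k ε m old new) (𝓝[>] 0) (𝓝 (listProb k 0 m old new)) := by
  have h := tendsto_rpow_nhdsGT_zero hk
  unfold listProb
  cases m
  · dsimp only
    split_ifs
    · exact h.const_sub 1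
    · exact h.div_const _
  · exact tendsto_const_nhds

variable {ε t r r' : ℝ} {m m' : Mood} {l l' : CUList NC K}

theorem moodProb_nonneg (hε : ε ∈ Set.Ico (0 : ℝ) 1) (hr' : r' < 1) :
    0 ≤ moodProb ε t m l r l' r' m' := by
  have h0 := Real.rpow_nonneg hε.1 (1 - r')
  have h1 := Real.rpow_le_one hε.1 hε.2.le (sub_pos.2 hr').le
  unfold moodProb
  split_ifs <;> cases m' <;> simp [h0, h1]

theorem sum_moodProb : ∑ m', moodProb ε t m l r l' r' m' = 1 := by
  have : (Finset.univ : Finset Mood) = {Mood.content, Mood.discontent} := rfl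
  rw [this, Finset.sum_pair (by simp)]
  unfold moodProb
  split_ifs <;> simp

/-- No probability goes to the mood profiles that `State` excludes. The hypothesis on `r` covers a
content player whose list and utility are unchanged. -/
theorem moodProb_eq_zero (h : m = Mood.content → t ≤ r) (hr' : ¬ t ≤ r') :
    moodProb ε t m l r l' r' Mood.content = 0 := by
  unfold moodProb
  rw [if_neg, if_neg hr']
  rintro ⟨hm, heq⟩
  exact hr' ((h hm).trans_eq (Prod.ext_iff.1 heq).2)

/-- The part `1 - r` of a player of mood `m` in the potential. -/
noncomputable def moodCost (m : Mood) (r : ℝ) : ℝ :=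
  match m with
  | Mood.content => 1 - r
  | Mood.discontent => 0

/-- A player who stays content has unchanged cost; becoming content has probability `ε ^ (1 - r')`
at most; for the new mood discontent the exponent is nonpositive, so the bound is at least one. -/
theorem moodProb_le (hε : ε ∈ Set.Ioo (0 : ℝ) 1) (hr : r < 1) (hr' : r' < 1) :
    moodProb ε t m l r l' r' m' ≤ ε ^ (moodCost m' r' - moodCost m r) := by
  have h0 := Real.rpow_pos_of_pos hε.1 (1 - r')
  have hm : 0 ≤ moodCost m r := by
    cases m <;> simp [moodCost, hr.le]
  cases m'
  · have hle : ε ^ (1 - r') ≤ ε ^ (1 - r' - moodCost m r) :=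
      Real.rpow_le_rpow_of_exponent_ge hε.1 hε.2.le (by linarith)
    unfold moodProb
    split_ifs with h₁ h₂
    · obtain ⟨rfl, heq⟩ := h₁
      obtain rfl := (Prod.ext_iff.1 heq).2
      simp [moodCost]
    · exact hle
    · exact h0.le.trans hle
  · have hle : 1 ≤ ε ^ (moodCost Mood.discontent r' - moodCost m r) := by
      refine Real.one_le_rpow_of_pos_of_le_one_of_nonpos hε.1 hε.2.le ?_
      simpa [moodCost] using hm
    refine le_trans ?_ hle
    unfold moodProb
    split_ifs <;> simp [h0.le]

theorem isPowerSum_moodProb : IsPowerSum (fun ε => moodProb ε t m l r l' r' m') := by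
  unfold moodProb
  split_ifs <;> cases m'
  exacts [.const _, .const _, .rpow _, .one_sub_rpow _, .const _, .const _]

theorem tendsto_moodProb (hr' : r' < 1) :
    Tendsto (fun ε => moodProb ε t m l r l' r' m') (𝓝[>] 0)
      (𝓝 (moodProb 0 t m l r l' r' m')) := by
  have h := tendsto_rpow_nhdsGT_zero (sub_pos.2 hr')
  unfold moodProb
  split_ifs <;> cases m'
  exacts [tendsto_const_nhds, tendsto_const_nhds, h, h.const_sub 1, tendsto_const_nhds,
    tendsto_const_nhds]

theorem moodProb_discontent_pos (hε : ε ∈ Set.Ioo (0 : ℝ) 1) (hr' : r' < 1)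
    (h : m' = Mood.content → t ≤ r') : 0 < moodProb ε t Mood.discontent l r l' r' m' := by
  have h0 := Real.rpow_pos_of_pos hε.1 (1 - r')
  have h1 := Real.rpow_lt_one hε.1.le hε.2 (sub_pos.2 hr')
  unfold moodProb
  cases m'
  · simp [h rfl, h0]
  · simp only [reduceCtorEq, false_and, if_false]
    split_ifs <;> simp [h1]

open Classical in
/-- The mood after a frame in which no player becomes content. -/
noncomputable def settledMood (m : Mood) (l : CUList NC K) (r : ℝ) (l' : CUList NC K) (r' : ℝ) :
    Mood :=
  if m = Mood.content ∧ (l, r) = (l', r') then Mood.content else Mood.discontent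

theorem le_moodProb_settledMood (hε : ε ∈ Set.Ioo (0 : ℝ) 1) :
    1 - ε ^ (1 - r') ≤ moodProb ε t m l r l' r' (settledMood m l r l' r') := by
  have h0 := Real.rpow_pos_of_pos hε.1 (1 - r')
  unfold moodProb settledMood
  split_ifs <;> simp [h0.le]

end PlayerProbabilities

/-! ### The transition matrix and its regularity. -/

namespace D2DNetwork

variable {ND NC K : ℕ} {N : D2DNetwork ND NC}

theorem State.ext_of_aligned {s t : N.State K} (hs : s.Aligned) (ht : t.Aligned)
    (hact : s.act = t.act) (hmood : s.mood = t.mood) : s = t := by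
  have hutil : s.util = t.util := funext fun d => by rw [hs d, ht d, hact]
  exact Subtype.ext (Prod.ext hact (Prod.ext (Subtype.ext hutil) hmood))

/-- The aligned state with given action and mood profiles. -/
noncomputable def alignedState (N : D2DNetwork ND NC) (l : ActionProfile ND NC K)
    (m : Fin ND → Mood) (h : ∀ d, m d = Mood.content → N.rateTgt d ≤ N.utility l d) : N.State K :=
  ⟨(l, ⟨N.utility l, l, rfl⟩, m), h⟩

theorem alignedState_aligned (l : ActionProfile ND NC K) (m : Fin ND → Mood)
    (h : ∀ d, m d = Mood.content → N.rateTgt d ≤ N.utility l d) :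
    (N.alignedState l m h).Aligned := fun _ => rfl

theorem State.rateTgt_le (s : N.State K) {d : Fin ND} (h : s.mood d = Mood.content) :
    N.rateTgt d ≤ s.util d := s.2 d h

theorem State.exists_utility_eq (s : N.State K) :
    ∃ l : ActionProfile ND NC K, N.utility l = s.util := s.1.2.1.2

theorem transition_of_aligned {k ε : ℝ} {s t : N.State K} (ht : t.Aligned) :
    N.transition k ε s t = ∏ d, listProb k ε (s.mood d) (s.act d) (t.act d) *
      moodProb ε (N.rateTgt d) (s.mood d) (s.act d) (s.util d) (t.act d) (t.util d) (t.mood d) :=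
  if_pos ht

theorem transition_of_not_aligned {k ε : ℝ} {s t : N.State K} (ht : ¬ t.Aligned) :
    N.transition k ε s t = 0 := if_neg ht

theorem sum_transition (k ε : ℝ) (hL : 2 ≤ Fintype.card (CUList NC K)) (s : N.State K) :
    ∑ t, N.transition k ε s t = 1 := by
  classical
  let F : ActionProfile ND NC K × (Fin ND → Mood) → ℝ := fun x =>
    ∏ d, listProb k ε (s.mood d) (s.act d) (x.1 d) *
      moodProb ε (N.rateTgt d) (s.mood d) (s.act d) (s.util d) (x.1 d) (N.utility x.1 d) (x.2 d)
  have h₁ : ∑ t, N.transition k ε s t =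
      ∑ t ∈ Finset.univ.filter (fun t : N.State K => t.Aligned), N.transition k ε s t := by
    refine (Finset.sum_filter_of_ne fun t _ ht => ?_).symm
    by_contra h
    exact ht (transition_of_not_aligned h)
  have h₂ : ∑ t ∈ Finset.univ.filter (fun t : N.State K => t.Aligned), N.transition k ε s t =
      ∑ x ∈ Finset.univ.filter (fun x : ActionProfile ND NC K × (Fin ND → Mood) =>
        ∀ d, x.2 d = Mood.content → N.rateTgt d ≤ N.utility x.1 d), F x := by
    refine Finset.sum_bij' (fun t _ => (t.act, t.mood))
      (fun x hx => N.alignedState x.1 x.2 (Finset.mem_filter.1 hx).2) ?_ ?_ ?_ ?_ ?_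
    · intro t ht
      refine Finset.mem_filter.2 ⟨Finset.mem_univ _, fun d hd => ?_⟩
      rw [← (Finset.mem_filter.1 ht).2 d]
      exact t.rateTgt_le hd
    · intro x hx
      exact Finset.mem_filter.2 ⟨Finset.mem_univ _, alignedState_aligned _ _ _⟩
    · intro t ht
      exact State.ext_of_aligned (alignedState_aligned _ _ _) (Finset.mem_filter.1 ht).2 rfl rfl
    · intro x hx
      rfl
    · intro t ht
      have ht' := (Finset.mem_filter.1 ht).2
      rw [transition_of_aligned ht']
      exact Finset.prod_congr rfl fun d _ => by rw [ht' d]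
  -- Dropping the constraint that content players meet their targets adds only zero terms, after
  -- which the sum over all profiles factors over the players.
  have h₃ : ∑ x ∈ Finset.univ.filter (fun x : ActionProfile ND NC K × (Fin ND → Mood) =>
        ∀ d, x.2 d = Mood.content → N.rateTgt d ≤ N.utility x.1 d), F x = ∑ x, F x := by
    refine Finset.sum_filter_of_ne fun x _ hx d hd => ?_
    by_contra hlt
    refine hx (Finset.prod_eq_zero (Finset.mem_univ d) ?_)
    rw [hd, moodProb_eq_zero (fun h => s.rateTgt_le h) hlt, mul_zero]
  rw [h₁, h₂, h₃, Fintype.sum_prod_type]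
  have h₄ : ∀ l : ActionProfile ND NC K, ∑ m : Fin ND → Mood, F (l, m) =
      ∏ d, listProb k ε (s.mood d) (s.act d) (l d) := by
    intro l
    have := Finset.prod_univ_sum (fun _ : Fin ND => (Finset.univ : Finset Mood))
      (fun d m => listProb k ε (s.mood d) (s.act d) (l d) *
        moodProb ε (N.rateTgt d) (s.mood d) (s.act d) (s.util d) (l d) (N.utility l d) m)
    rw [Fintype.piFinset_univ] at this
    rw [← this]
    exact Finset.prod_congr rfl fun d _ => by rw [← Finset.mul_sum, sum_moodProb, mul_one]
  have h₅ := Finset.prod_univ_sum (fun _ : Fin ND => (Finset.univ : Finset (CUList NC K)))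
      (fun d l => listProb k ε (s.mood d) (s.act d) l)
  rw [Fintype.piFinset_univ] at h₅
  rw [Finset.sum_congr rfl fun l _ => h₄ l, ← h₅]
  exact Finset.prod_eq_one fun d _ => sum_listProb k ε hL _ _

theorem State.util_lt_one
    (hnorm : ∀ (l : ActionProfile ND NC K) (d : Fin ND), 0 ≤ N.utility l d ∧ N.utility l d < 1)
    (s : N.State K) (d : Fin ND) : s.util d < 1 := by
  obtain ⟨l, hl⟩ := s.exists_utility_eq
  rw [← hl]
  exact (hnorm l d).2

theorem isTransitionMatrix_transition {k ε : ℝ} (hk : 0 < k)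
    (hL : 2 ≤ Fintype.card (CUList NC K))
    (hnorm : ∀ (l : ActionProfile ND NC K) (d : Fin ND), 0 ≤ N.utility l d ∧ N.utility l d < 1)
    (hε : ε ∈ Set.Ico (0 : ℝ) 1) : IsTransitionMatrix (N.transition (K := K) k ε) := by
  refine ⟨fun s t => ?_, sum_transition k ε hL⟩
  by_cases ht : t.Aligned
  · rw [transition_of_aligned ht]
    exact Finset.prod_nonneg fun d _ => mul_nonneg (listProb_nonneg hε hk hL _ _ _)
      (moodProb_nonneg hε (t.util_lt_one hnorm d))
  · rw [transition_of_not_aligned ht]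

theorem isPowerSum_transition (k : ℝ) (s t : N.State K) :
    IsPowerSum (fun ε => N.transition k ε s t) := by
  by_cases ht : t.Aligned
  · simp only [transition_of_aligned ht]
    exact .prod _ fun d => (isPowerSum_listProb k _ _ _).mul isPowerSum_moodProb
  · simp only [transition_of_not_aligned ht]
    exact .const 0

theorem tendsto_transition {k : ℝ} (hk : 0 < k)
    (hnorm : ∀ (l : ActionProfile ND NC K) (d : Fin ND), 0 ≤ N.utility l d ∧ N.utility l d < 1)
    (s t : N.State K) :
    Tendsto (fun ε => N.transition k ε s t) (𝓝[>] 0) (𝓝 (N.transition k 0 s t)) := by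
  by_cases ht : t.Aligned
  · simp only [transition_of_aligned ht]
    exact tendsto_finsetProd _ fun d _ =>
      (tendsto_listProb hk _ _ _).mul (tendsto_moodProb (t.util_lt_one hnorm d))
  · simp only [transition_of_not_aligned ht]
    exact tendsto_const_nhds

/-- The state after a frame in which the action profile `l` is chosen and no player becomes
content. -/
noncomputable def settle (s : N.State K) (l : ActionProfile ND NC K) : N.State K :=
  N.alignedState l
    (fun d => settledMood (s.mood d) (s.act d) (s.util d) (l d) (N.utility l d)) fun d hd => by
      unfold settledMood at hd
      split_ifs at hd with h
      exact (s.rateTgt_le h.1).trans_eq (Prod.ext_iff.1 h.2).2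

theorem settle_aligned (s : N.State K) (l : ActionProfile ND NC K) : (settle s l).Aligned :=
  alignedState_aligned _ _ _

theorem transition_settle_pos {k ε : ℝ} (hk : 0 < k) (hL : 2 ≤ Fintype.card (CUList NC K))
    (hnorm : ∀ (l : ActionProfile ND NC K) (d : Fin ND), 0 ≤ N.utility l d ∧ N.utility l d < 1)
    (hε : ε ∈ Set.Ioo (0 : ℝ) 1) (s : N.State K) (l : ActionProfile ND NC K) :
    0 < N.transition k ε s (settle s l) := by
  rw [transition_of_aligned (settle_aligned s l)]
  refine Finset.prod_pos fun d _ => mul_pos (listProb_pos hε hk hL _ _ _) ?_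
  refine lt_of_lt_of_le ?_ (le_moodProb_settledMood hε)
  exact sub_pos.2 (Real.rpow_lt_one hε.1.le hε.2 (sub_pos.2 (hnorm l d).2))

theorem transition_pos_of_discontent {k ε : ℝ} (hk : 0 < k)
    (hL : 2 ≤ Fintype.card (CUList NC K))
    (hnorm : ∀ (l : ActionProfile ND NC K) (d : Fin ND), 0 ≤ N.utility l d ∧ N.utility l d < 1)
    (hε : ε ∈ Set.Ioo (0 : ℝ) 1) {s t : N.State K} (hs : ∀ d, s.mood d = Mood.discontent)
    (ht : t.Aligned) : 0 < N.transition k ε s t := by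
  rw [transition_of_aligned ht]
  refine Finset.prod_pos fun d _ => mul_pos (listProb_pos hε hk hL _ _ _) ?_
  rw [hs d]
  exact moodProb_discontent_pos hε (t.util_lt_one hnorm d) t.rateTgt_le

/-- Two frames suffice: if every player changes its list, all can become discontent, and from there
every aligned state is reachable in one frame. -/
theorem exists_transition_pow_pos {k ε : ℝ} (hk : 0 < k) (hL : 2 ≤ Fintype.card (CUList NC K))
    (hnorm : ∀ (l : ActionProfile ND NC K) (d : Fin ND), 0 ≤ N.utility l d ∧ N.utility l d < 1)
    (hε : ε ∈ Set.Ioo (0 : ℝ) 1) :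
    ∃ n : ℕ, ∀ s, ∀ t ∈ {t : N.State K | t.Aligned}, 0 < (N.transition k ε ^ n) s t := by
  have hnt : Nontrivial (CUList NC K) := Fintype.one_lt_card_iff_nontrivial.1 hL
  refine ⟨2, fun s t ht => ?_⟩
  have hP := isTransitionMatrix_transition hk hL hnorm (Set.Ioo_subset_Ico_self hε)
  choose f hf using fun d => exists_ne (s.act d)
  rw [pow_two, Matrix.mul_apply]
  refine Finset.sum_pos' (fun u _ => mul_nonneg (hP.1 s u) (hP.1 u t))
    ⟨settle s f, Finset.mem_univ _, mul_pos (transition_settle_pos hk hL hnorm hε s f)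
      (transition_pos_of_discontent hk hL hnorm hε (fun d => ?_) ht)⟩
  refine if_neg fun h => hf d (Prod.ext_iff.1 h.2).1.symm

theorem isRegularPerturbation_transition {k : ℝ} (hk : 0 < k)
    (hL : 2 ≤ Fintype.card (CUList NC K))
    (hnorm : ∀ (l : ActionProfile ND NC K) (d : Fin ND),
      0 ≤ N.utility l d ∧ N.utility l d < 1) :
    IsRegularPerturbation (fun ε => N.transition (K := K) k ε) {s | s.Aligned} := by
  have hP := fun ε (hε : ε ∈ Set.Ico (0 : ℝ) 1) => isTransitionMatrix_transition hk hL hnorm hε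
  refine ⟨hP, fun ε hε => ⟨exists_transition_pow_pos hk hL hnorm hε,
    fun s _ t ht => transition_of_not_aligned ht⟩, tendsto_transition hk hnorm, ?_⟩
  intro s t hst
  have hP' := fun ε (hε : ε ∈ Set.Ioo (0 : ℝ) 1) => hP ε (Set.Ioo_subset_Ico_self hε)
  obtain ⟨p, hp⟩ := isPowerSum_transition k s t
  obtain ⟨ρ, a, ha, h⟩ := exists_leading_term_div (f := fun ε => N.transition k ε s t) (p := p)
    (q := 1) (fun ε hε => by rw [map_one, div_one]; exact hp ε hε) (fun ε hε => (hP' ε hε).1 s t) hst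
  refine ⟨ρ, exponent_nonneg_of_bounded (C := 1) ha h fun ε hε => ?_, a, ha, h⟩
  rw [← (hP' ε hε).2 s]
  exact Finset.single_le_sum (f := fun u => N.transition k ε s u)
    (fun u _ => (hP' ε hε).1 s u) (Finset.mem_univ t)

end D2DNetwork

/-! ### The potential of the chain: upper and lower bounds on transitions. -/

theorem moodCost_settledMood_le {NC K : ℕ} {m : Mood} {l l' : CUList NC K} {r r' : ℝ}
    (hr : r < 1) : moodCost (settledMood m l r l' r') r' ≤ moodCost m r := by
  by_cases h : m = Mood.content ∧ (l, r) = (l', r')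
  · obtain ⟨rfl, heq⟩ := h
    obtain rfl : r = r' := (Prod.ext_iff.1 heq).2
    simp [settledMood, heq]
  · rw [settledMood, if_neg h]
    cases m <;> simp [moodCost, hr.le]

namespace D2DNetwork

variable {ND NC K : ℕ} {N : D2DNetwork ND NC}

/-- The sum of `1 - r_d` over the content players. -/
noncomputable def potential (s : N.State K) : ℝ := ∑ d, moodCost (s.mood d) (s.util d)

/-- The aligned states in which all players are content. -/
def contentStates (N : D2DNetwork ND NC) (K : ℕ) : Set (N.State K) :=
  {s | s.Aligned ∧ ∀ d, s.mood d = Mood.content}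

open Classical in
/-- Exponent of the probability that a state is left. -/
noncomputable def exitCost (k : ℝ) (s : N.State K) : ℝ :=
  if s ∈ N.contentStates K then k else 0

theorem moodCost_nonneg
    (hnorm : ∀ (l : ActionProfile ND NC K) (d : Fin ND), 0 ≤ N.utility l d ∧ N.utility l d < 1)
    (s : N.State K) (d : Fin ND) : 0 ≤ moodCost (s.mood d) (s.util d) := by
  have := s.util_lt_one hnorm d
  cases s.mood d <;> simp [moodCost, this.le]

theorem potential_nonneg
    (hnorm : ∀ (l : ActionProfile ND NC K) (d : Fin ND), 0 ≤ N.utility l d ∧ N.utility l d < 1)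
    (s : N.State K) : 0 ≤ potential s :=
  Finset.sum_nonneg fun d _ => moodCost_nonneg hnorm s d

theorem mood_eq_discontent_of_potential_eq_zero
    (hnorm : ∀ (l : ActionProfile ND NC K) (d : Fin ND), 0 ≤ N.utility l d ∧ N.utility l d < 1)
    {s : N.State K} (h : potential s = 0) (d : Fin ND) : s.mood d = Mood.discontent := by
  have := (Finset.sum_eq_zero_iff_of_nonneg fun d _ => moodCost_nonneg hnorm s d).1 h d
    (Finset.mem_univ d)
  have := s.util_lt_one hnorm d
  cases hm : s.mood d
  · simp only [hm, moodCost] at *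
    linarith
  · rfl

theorem exists_content_of_potential_ne_zero {s : N.State K} (h : potential s ≠ 0) :
    ∃ d, s.mood d = Mood.content := by
  by_contra! hn
  refine h (Finset.sum_eq_zero fun d _ => ?_)
  have := hn d
  cases hm : s.mood d
  · exact absurd hm this
  · rfl

theorem potential_eq_of_mem_contentStates {s : N.State K} (h : s ∈ N.contentStates K) :
    potential s = ND - N.socialUtility s.act := by
  have : ∀ d, moodCost (s.mood d) (s.util d) = 1 - N.utility s.act d := fun d => by
    rw [h.2 d, h.1 d]; rfl
  simp [potential, this, socialUtility]

theorem potential_le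
    (hnorm : ∀ (l : ActionProfile ND NC K) (d : Fin ND), 0 ≤ N.utility l d ∧ N.utility l d < 1)
    {s : N.State K} (h : s ∈ N.contentStates K) : potential s ≤ ND := by
  rw [potential_eq_of_mem_contentStates h]
  have : 0 ≤ N.socialUtility s.act := Finset.sum_nonneg fun d _ => (hnorm s.act d).1
  linarith

/-- The bounds for the players multiply, so the exponent contains the sum of the list costs. From an
all-content state this sum is at least `k` once a list changes; if none changes, utilities are the
same and nobody can become discontent, so a different target has probability zero. -/
theorem transition_le {k ε : ℝ} (hk : 0 < k) (hL : 2 ≤ Fintype.card (CUList NC K))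
    (hnorm : ∀ (l : ActionProfile ND NC K) (d : Fin ND), 0 ≤ N.utility l d ∧ N.utility l d < 1)
    (hε : ε ∈ Set.Ioo (0 : ℝ) 1) {s t : N.State K} (hs : s.Aligned) (ht : t.Aligned)
    (hst : s ≠ t) :
    N.transition k ε s t ≤ ε ^ (potential t - potential s + exitCost k s) := by
  have hcost : ∀ d, 0 ≤ listCost k (s.mood d) (s.act d) (t.act d) := fun d => by
    unfold listCost; split_ifs <;> simp [hk.le]
  have hle : N.transition k ε s t ≤ ε ^ (potential t - potential s +
      ∑ d, listCost k (s.mood d) (s.act d) (t.act d)) := by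
    rw [transition_of_aligned ht, potential, potential, ← Finset.sum_sub_distrib,
      ← Finset.sum_add_distrib, Real.rpow_sum_of_pos hε.1]
    refine Finset.prod_le_prod (fun d _ => mul_nonneg (listProb_pos hε hk hL _ _ _).le
      (moodProb_nonneg (Set.Ioo_subset_Ico_self hε) (t.util_lt_one hnorm d))) fun d _ => ?_
    rw [add_comm, Real.rpow_add hε.1]
    exact mul_le_mul (listProb_le hε hL _ _ _)
      (moodProb_le hε (s.util_lt_one hnorm d) (t.util_lt_one hnorm d))
      (moodProb_nonneg (Set.Ioo_subset_Ico_self hε) (t.util_lt_one hnorm d))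
      (Real.rpow_nonneg hε.1.le _)
  by_cases hC : s ∈ N.contentStates K
  · by_cases hact : s.act = t.act
    · obtain ⟨d, hd⟩ : ∃ d, t.mood d = Mood.discontent := by
        by_contra! hn
        refine hst (State.ext_of_aligned hs ht hact (funext fun d => ?_))
        rw [hC.2 d]
        have := hn d
        cases hm : t.mood d
        · rfl
        · exact absurd hm this
      have hzero : N.transition k ε s t = 0 := by
        rw [transition_of_aligned ht]
        refine Finset.prod_eq_zero (Finset.mem_univ d) ?_
        have : s.util d = t.util d := by rw [hs d, ht d, hact]
        rw [hd, hC.2 d, this, hact]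
        simp [moodProb]
      rw [hzero]
      exact Real.rpow_nonneg hε.1.le _
    · obtain ⟨d, hd⟩ := Function.ne_iff.1 hact
      refine hle.trans (Real.rpow_le_rpow_of_exponent_ge hε.1 hε.2.le ?_)
      have h₁ := Finset.single_le_sum (fun d _ => hcost d) (Finset.mem_univ d)
      have h₂ : listCost k (s.mood d) (s.act d) (t.act d) = k := if_pos ⟨hC.2 d, hd.symm⟩
      rw [h₂] at h₁
      rw [exitCost, if_pos hC]
      linarith
  · refine hle.trans (Real.rpow_le_rpow_of_exponent_ge hε.1 hε.2.le ?_)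
    have := Finset.sum_nonneg fun d (_ : d ∈ Finset.univ) => hcost d
    rw [exitCost, if_neg hC]
    linarith

theorem potential_settle_lt
    (hnorm : ∀ (l : ActionProfile ND NC K) (d : Fin ND), 0 ≤ N.utility l d ∧ N.utility l d < 1)
    {s : N.State K} {l : ActionProfile ND NC K} {d : Fin ND} (hd : s.mood d = Mood.content)
    (h : (s.act d, s.util d) ≠ (l d, N.utility l d)) :
    potential (settle s l) < potential s := by
  refine Finset.sum_lt_sum (fun d _ => moodCost_settledMood_le (s.util_lt_one hnorm d))
    ⟨d, Finset.mem_univ d, ?_⟩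
  have hm : (settle s l).mood d = Mood.discontent := if_neg fun h' => h h'.2
  have := s.util_lt_one hnorm d
  rw [hm, hd]
  simpa [moodCost] using this

/-- Only list changes by content players cost powers of `ε`: when nobody becomes content, each mood
factor is eventually at least `1 / 2`. -/
theorem eventually_le_transition_settle {k : ℝ} (hk : 0 < k)
    (hL : 2 ≤ Fintype.card (CUList NC K))
    (hnorm : ∀ (l : ActionProfile ND NC K) (d : Fin ND), 0 ≤ N.utility l d ∧ N.utility l d < 1)
    (s : N.State K) (l : ActionProfile ND NC K) :
    ∃ c : ℝ, 0 < c ∧ ∀ᶠ ε in 𝓝[>] 0,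
      c * ε ^ (∑ d, listCost k (s.mood d) (s.act d) (l d)) ≤ N.transition k ε s (settle s l) := by
  set c : ℝ := 1 / (2 * Fintype.card (CUList NC K) : ℝ) * (1 / 2) with hc
  have hc0 : 0 < c := by
    have : (0 : ℝ) < Fintype.card (CUList NC K) := by
      exact_mod_cast lt_of_lt_of_le two_pos hL
    positivity
  refine ⟨∏ _d : Fin ND, c, Finset.prod_pos fun _ _ => hc0, ?_⟩
  have h₁ := eventually_all.2 fun d => eventually_le_listProb hk hL (s.mood d) (s.act d) (l d)
  have h₂ := eventually_all.2 fun d =>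
    (tendsto_rpow_zero_right (sub_pos.2 (hnorm l d).2)).eventually_lt_const one_half_pos
  filter_upwards [eventually_mem_Ioo, h₁, h₂] with ε hε h₁ h₂
  rw [transition_of_aligned (settle_aligned s l), Real.rpow_sum_of_pos hε.1,
    ← Finset.prod_mul_distrib]
  refine Finset.prod_le_prod (fun d _ => mul_nonneg hc0.le (Real.rpow_nonneg hε.1.le _))
    fun d _ => ?_
  have h₃ : 1 / 2 ≤ moodProb ε (N.rateTgt d) (s.mood d) (s.act d) (s.util d)
      ((settle s l).act d) ((settle s l).util d) ((settle s l).mood d) := by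
    refine le_trans ?_ (le_moodProb_settledMood hε)
    have := h₂ d
    change 1 / 2 ≤ 1 - ε ^ (1 - N.utility l d)
    linarith
  rw [hc, mul_right_comm]
  exact mul_le_mul (h₁ d) h₃ one_half_pos.le (listProb_pos hε hk hL _ _ _).le

/-- In an all-content state one player experiments, at cost exactly `k`. Otherwise the discontent
players form a nonempty proper subset, and interdependence lets them change the utility of a content
player at no cost, which makes it discontent. -/
theorem exists_transition_potential_lt {k : ℝ} (hk : 0 < k)
    (hL : 2 ≤ Fintype.card (CUList NC K))
    (hnorm : ∀ (l : ActionProfile ND NC K) (d : Fin ND), 0 ≤ N.utility l d ∧ N.utility l d < 1)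
    (hint : N.Interdependent K) {s : N.State K} (hs : s.Aligned) (hV : potential s ≠ 0) :
    ∃ t, potential t < potential s ∧ ∃ c : ℝ, 0 < c ∧
      ∀ᶠ ε in 𝓝[>] 0, c * ε ^ exitCost k s ≤ N.transition k ε s t := by
  classical
  obtain ⟨d₀, hd₀⟩ := exists_content_of_potential_ne_zero hV
  by_cases hC : s ∈ N.contentStates K
  · have hnt : Nontrivial (CUList NC K) := Fintype.one_lt_card_iff_nontrivial.1 hL
    obtain ⟨x, hx⟩ := exists_ne (s.act d₀)
    set l := Function.update s.act d₀ x with hl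
    have hld : l d₀ = x := Function.update_self _ _ _
    have hcost : ∑ d, listCost k (s.mood d) (s.act d) (l d) = exitCost k s := by
      rw [exitCost, if_pos hC, Finset.sum_eq_single d₀]
      · exact if_pos ⟨hd₀, by rwa [hld]⟩
      · intro d _ hd
        exact if_neg fun h => h.2 (Function.update_of_ne hd _ _)
      · simp
    refine ⟨settle s l, potential_settle_lt hnorm hd₀ fun h => hx ?_, ?_⟩
    · rw [← hld]
      exact (Prod.ext_iff.1 h).1.symm
    · rw [← hcost]
      exact eventually_le_transition_settle hk hL hnorm s l
  · set A := Finset.univ.filter (fun d => s.mood d ≠ Mood.content) with hA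
    have hA₁ : A.Nonempty := by
      by_contra hn
      refine hC ⟨hs, fun d => ?_⟩
      by_contra hd
      exact hn ⟨d, by simpa [hA] using hd⟩
    have hA₂ : A ≠ Finset.univ := fun h => by
      have := h ▸ Finset.mem_univ d₀
      simp [hA, hd₀] at this
    obtain ⟨d, hdA, l, hl, hne⟩ := hint s.act A hA₁ hA₂
    have hcost : ∑ d, listCost k (s.mood d) (s.act d) (l d) = exitCost k s := by
      rw [exitCost, if_neg hC]
      refine Finset.sum_eq_zero fun e _ => if_neg fun h => h.2 (hl e ?_)
      simp [hA, h.1]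
    refine ⟨settle s l, potential_settle_lt hnorm (d := d) ?_ fun h => hne ?_, ?_⟩
    · simpa [hA] using hdA
    · rw [← hs d]
      exact (Prod.ext_iff.1 h).2.symm
    · rw [← hcost]
      exact eventually_le_transition_settle hk hL hnorm s l

theorem transition_from_discontent {k : ℝ} {u z : N.State K}
    (hu : ∀ d, u.mood d = Mood.discontent) (hz : z ∈ N.contentStates K) {ε : ℝ}
    (hε : ε ∈ Set.Ioo (0 : ℝ) 1) :
    N.transition k ε u z =
      (∏ _d : Fin ND, 1 / (Fintype.card (CUList NC K) : ℝ)) * ε ^ potential z := by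
  rw [transition_of_aligned hz.1, potential, Real.rpow_sum_of_pos hε.1,
    ← Finset.prod_mul_distrib]
  refine Finset.prod_congr rfl fun d _ => ?_
  have := z.rateTgt_le (hz.2 d)
  rw [hu d, hz.2 d]
  simp [listProb, moodProb, moodCost, this]

theorem one_sub_transition_self_le {k : ℝ} (hk : 0 < k) {z : N.State K}
    (hz : z ∈ N.contentStates K) {ε : ℝ} (hε : ε ∈ Set.Ioo (0 : ℝ) 1) :
    1 - N.transition k ε z z ≤ ND * ε ^ k := by
  have h : N.transition k ε z z = (1 + -ε ^ k) ^ ND := by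
    rw [transition_of_aligned hz.1]
    simp [hz.2, listProb, moodProb, sub_eq_add_neg]
  have h₁ := Real.rpow_le_one hε.1.le hε.2.le hk.le
  -- Bernoulli's inequality for the probability `(1 - ε ^ k) ^ ND` that nobody experiments.
  have := one_add_mul_le_pow (a := -ε ^ k) (by linarith) ND
  rw [h]
  linarith

/-- All-content aligned states correspond to feasible profiles, and on them the potential is `ND`
minus the social utility. -/
theorem mem_contentStates_and_potential_min_iff (s : N.State K) :
    (s ∈ N.contentStates K ∧ ∀ z ∈ N.contentStates K, potential s ≤ potential z) ↔
      (∀ d, s.mood d = Mood.content) ∧ (∀ d, s.util d = N.utility s.act d) ∧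
        N.IsOptimal s.act := by
  constructor
  · rintro ⟨hs, hmin⟩
    refine ⟨hs.2, hs.1, fun d => ?_, fun l hl => ?_⟩
    · rw [← hs.1 d]
      exact s.rateTgt_le (hs.2 d)
    · have hz : N.alignedState l (fun _ => Mood.content) (fun d _ => hl d) ∈ N.contentStates K :=
        ⟨alignedState_aligned _ _ _, fun _ => rfl⟩
      have := hmin _ hz
      rw [potential_eq_of_mem_contentStates hs, potential_eq_of_mem_contentStates hz] at this
      change _ ≤ (ND : ℝ) - N.socialUtility l at this
      linarith
  · rintro ⟨hm, hal, hopt⟩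
    have hs : s ∈ N.contentStates K := ⟨hal, hm⟩
    refine ⟨hs, fun z hz => ?_⟩
    rw [potential_eq_of_mem_contentStates hs, potential_eq_of_mem_contentStates hz]
    have := hopt.2 z.act fun d => by
      rw [← hz.1 d]
      exact z.rateTgt_le (hz.2 d)
    linarith

theorem isOptimal_of_isEmpty [IsEmpty (Fin ND)] (l : ActionProfile ND NC K) : N.IsOptimal l :=
  ⟨fun d => isEmptyElim d, fun l' _ => by rw [Subsingleton.elim l' l]⟩

end D2DNetwork

/-! ### Assembly of the theorem. -/

theorem theorem1 {ND NC K : ℕ} (N : D2DNetwork ND NC) (k : ℝ) (hk : (ND : ℝ) < k)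
    (hL : 2 ≤ Fintype.card (CUList NC K))
    (hnorm : ∀ (l : ActionProfile ND NC K) (d : Fin ND),
      0 ≤ N.utility l d ∧ N.utility l d < 1)
    (hint : N.Interdependent K)
    (hfeas : ∃ l : ActionProfile ND NC K, N.Feasible l) :
    IsRegularPerturbation (fun ε => N.transition (K := K) k ε) {s | s.Aligned} ∧
    ∃ (π : ℝ → N.State K → ℝ) (π₀ : N.State K → ℝ),
      (∀ ε ∈ Set.Ioo (0 : ℝ) 1, IsStationaryDist (N.transition k ε) (π ε) ∧
        ∀ μ, IsStationaryDist (N.transition k ε) μ → μ = π ε) ∧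
      Tendsto π (𝓝[>] 0) (𝓝 π₀) ∧
      IsStationaryDist (N.transition k 0) π₀ ∧
      ∀ s : N.State K, 0 < π₀ s ↔
        (∀ d, s.mood d = Mood.content) ∧
        (∀ d, s.util d = N.utility s.act d) ∧
        N.IsOptimal s.act := by
  have hk₀ : 0 < k := lt_of_le_of_lt (Nat.cast_nonneg ND) hk
  have hreg := D2DNetwork.isRegularPerturbation_transition hk₀ hL hnorm
  refine ⟨hreg, ?_⟩
  set R : Set (N.State K) := {s | s.Aligned} with hR
  have hP : ∀ ε ∈ Set.Ioo (0 : ℝ) 1, IsTransitionMatrix (N.transition (K := K) k ε) :=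
    fun ε hε => hreg.1 ε (Set.Ioo_subset_Ico_self hε)
  obtain ⟨l₀, hl₀⟩ := hfeas
  set s₀ : N.State K := N.alignedState l₀ (fun _ => Mood.content) (fun d _ => hl₀ d) with hs₀
  have hs₀C : s₀ ∈ N.contentStates K := ⟨D2DNetwork.alignedState_aligned _ _ _, fun _ => rfl⟩
  obtain ⟨π, hπ, hquot⟩ := exists_stationary_eq_div (P := fun ε => N.transition (K := K) k ε)
    (D2DNetwork.isPowerSum_transition k) hP s₀ fun ε hε =>
      (hreg.2.1 ε hε).1.imp fun n hn s => hn s s₀ hs₀C.1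
  have hπ' := fun ε hε => (hπ ε hε).1
  have hpos : ∀ s ∈ R, ∀ ε ∈ Set.Ioo (0 : ℝ) 1, 0 < π ε s := fun s hs ε hε => by
    obtain ⟨n, hn⟩ := (hreg.2.1 ε hε).1
    exact (hπ' ε hε).pos fun u => hn u s hs
  have hout : ∀ s ∉ R, ∀ ε ∈ Set.Ioo (0 : ℝ) 1, π ε s = 0 := fun s hs ε hε => by
    rw [← (hπ' ε hε).2.2 s]
    exact Finset.sum_eq_zero fun u _ => by
      rw [D2DNetwork.transition_of_not_aligned hs, mul_zero]
  have hexp : ∀ s, ∃ e : ℝ, s ∈ R →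
      ∃ a : ℝ, 0 < a ∧ Tendsto (fun ε => π ε s / ε ^ e) (𝓝[>] 0) (𝓝 a) := fun s => by
    by_cases hs : s ∈ R
    · obtain ⟨p, q, hpq⟩ := hquot s
      obtain ⟨e, h⟩ := exists_leading_term_div hpq (fun ε hε => (hπ' ε hε).1 s)
        ⟨1 / 2, by norm_num, hpos s hs _ (by norm_num)⟩
      exact ⟨e, fun _ => h⟩
    · exact ⟨0, fun h => absurd h hs⟩
  choose e he using hexp
  obtain ⟨π₀, hlim, hstat, hsupp⟩ := exists_limit_of_exponents hπ' he hout hreg.2.2.1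
  refine ⟨π, π₀, hπ, hlim, hstat, fun s => ?_⟩
  -- Otherwise the limit would vanish identically, against total mass one.
  have hzero : ∃ s ∈ R, e s = 0 := by
    by_contra! hn
    have : ∀ s, π₀ s = 0 := fun s =>
      le_antisymm (not_lt.1 fun h => hn s ((hsupp s).1 h).1 ((hsupp s).1 h).2) (hstat.1 s)
    have h1 := hstat.2.1
    simp [this] at h1
  -- Without players the all-content state also has potential zero, so the potential argument does
  -- not apply; but then there is only one state.
  rcases Nat.eq_zero_or_pos ND with rfl | hND
  · have hsub : ∀ t : N.State K, t = s := fun t =>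
      D2DNetwork.State.ext_of_aligned (fun d => isEmptyElim d) (fun d => isEmptyElim d)
        (Subsingleton.elim _ _) (Subsingleton.elim _ _)
    obtain ⟨t, ht⟩ := hzero
    rw [hsub t] at ht
    exact ⟨fun _ => ⟨fun d => isEmptyElim d, fun d => isEmptyElim d,
      D2DNetwork.isOptimal_of_isEmpty _⟩, fun _ => (hsupp s).2 ht⟩
  · rw [hsupp s, ← D2DNetwork.mem_contentStates_and_potential_min_iff s]
    have key := exponent_eq_zero_iff hP hπ' he hout hzero (V := D2DNetwork.potential)
      (κ := D2DNetwork.exitCost k) (C := N.contentStates K) (k := k) (fun s hs => hs.1)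
      ⟨s₀, hs₀C⟩ (fun s hs => if_pos hs) (fun s hs => if_neg hs)
      (fun s _ => D2DNetwork.potential_nonneg hnorm s)
      (fun s hs => (D2DNetwork.potential_le hnorm hs).trans_lt hk)
      (fun s hs h => by
        have := D2DNetwork.mood_eq_discontent_of_potential_eq_zero hnorm h ⟨0, hND⟩
        rw [hs.2] at this
        cases this)
      (fun s hs t ht hst ε hε => D2DNetwork.transition_le hk₀ hL hnorm hε hs ht hst)
      (fun s hs hV => D2DNetwork.exists_transition_potential_lt hk₀ hL hnorm hint hs hV)
      (fun u _ hV z hz => ⟨∏ _d : Fin ND, 1 / (Fintype.card (CUList NC K) : ℝ),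
        Finset.prod_pos fun _ _ => one_div_pos.2 (by exact_mod_cast lt_of_lt_of_le two_pos hL),
        fun ε hε => (D2DNetwork.transition_from_discontent
          (D2DNetwork.mood_eq_discontent_of_potential_eq_zero hnorm hV) hz hε).ge⟩)
      (fun z hz => ⟨ND, fun ε hε => D2DNetwork.one_sub_transition_self_le hk₀ hz hε⟩) s
    constructor
    · rintro ⟨hs, h0⟩
      exact (key hs).1 h0
    · intro h
      exact ⟨h.1.1, (key h.1.1).2 h⟩
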